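/- **Setting.** For $\lambda\in\mathbb N$ let $\mathbb Q_\lambda$ be the set of rationals $p/q$ with $\max\{|p|,|q|\}\le 2^\lambda$. A metric $\ell$ on a set $\mathcal Y$ is *$\lambda$-precise* if all its values lie in $\mathbb Q_\lambda$, and $\mathbb D_{d,\lambda}$ is the set of probability distributions $\mathcal D$ on $\{0,1\}^d$ whose mass function $Q_{\mathcal D}$ has all its values in $\mathbb Q_\lambda$. For $f,h:\{0,1\}^d\to\mathcal Y$ put $\mathcal L_{\mathcal D}(h,f)=\mathbb E_{x\sim\mathcal D}[\ell(f(x),h(x))]$. A *protocol* consists of a verifier $\mathcal V$, which is a randomized random access machine with query access to $f,h_0,h_1$ and $Q_{\mathcal D}$ that can evaluate $\ell$, and of two computationally unbounded provers $\mathcal P_0,\mathcal P_1$, which know $h_0,h_1$ and $Q_{\mathcal D}$ but not $f$; the verifier exchanges bit strings with each prover and outputs a bit $\rho$. All parties receive $d$ and the parameters $\varepsilon,\beta$ (presented as the integers $\lceil 1/\varepsilon\rceil$ and $\max\{0,\lceil\log_2(1/\beta)\rceil\}$). In the runtime, an operation on numbers counts as one step if its result fits into a machine word of $O(\log(d+\lambda+\lceil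 1/\varepsilon\rceil+\max\{0,\lceil\log_2(1/\beta)\rceil\}))$ bits, and as many steps as the result has bits otherwise; sending or receiving a string, tossing coins and writing a query in $\{0,1\}^d$ are charged for every bit; evaluating $\ell$ is charged for its arguments' addresses and its result only. **Theorem.** There are a constant $C$ and a polynomial $\mathrm{poly}$, both absolute, such that for every set $\mathcal Y$, every $\lambda\in\mathbb N$ and every $\lambda$-precise metric $\ell$ on $\mathcal Y$ there is a protocol $[\mathcal P_0,\mathcal P_1,\mathcal V]$ with the following properties for all inputs $d\in\mathbb N$ and $\varepsilon,\beta>0$. 1. It is a $(3+\varepsilon,\beta)$-refereed learning protocol for all functions and for $\mathbb D_{d,\lambda}$ with respect to $\ell$: for all $\mathcal D\in\mathbb D_{d,\lambda}$, all $f,h_0,h_1:\{0,1\}^d\to\mathcal Y$, all $b\in\{0,1\}$ and every (malicious, unbounded) strategy $\mathcal P^*_{1-b}$, the output $\rho$ of the interaction of $\mathcal P_b$, $\mathcal P^*_{1-b}$ and $\mathcal V$ satisfies $$\Pr\Bigl[\mathcal L_{\mathcal D}(h_\rho,f)\le(3+\varepsilon)\cdot\min_{s\in\{0,1\}}\mathcal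 L_{\mathcal D}(h_s,f)\Bigr]\ge 1-\beta .$$ 2. In every such interaction, for all outcomes of the coins, the number of bits communicated and the runtime of the verifier are each at most $$\bar\lambda\,\Bigl(1+\frac1{\varepsilon^2}\Bigr)\max\Bigl\{1,\log\Bigl(1+\frac1\varepsilon\Bigr)\Bigr\}\max\Bigl\{1,\log\frac1\beta\Bigr\}\cdot\mathrm{poly}(d),\qquad \bar\lambda=\max\{1,\lambda\},$$ and the verifier makes at most $C\bigl(1+\frac1{\varepsilon^2}\bigr)\max\bigl\{0,\log\frac1\beta\bigr\}$ queries to $f$. -/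

import Mathlib

namespace RefereedLearning

/-! ### Metrics, distributions and losses -/

/-- The Boolean cube `{0,1}^d`. -/
abbrev Cube (d : ℕ) : Type := Fin d → Bool

/-- The rationals `p / q` with `max (|p|, |q|) ≤ 2 ^ lam`. -/
def PreciseRat (lam : ℕ) : Set ℚ :=
  {r | ∃ p q : ℤ, q ≠ 0 ∧ |p| ≤ 2 ^ lam ∧ |q| ≤ 2 ^ lam ∧ r = (p : ℚ) / (q : ℚ)}

/-- `ℓ` is a metric on `Y` all of whose values lie in `PreciseRat lam`.  Since `PreciseRat lam`
consists of rationals, `ℓ` is taken rational-valued from the start. -/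
structure IsPreciseMetric {Y : Type*} (lam : ℕ) (ℓ : Y → Y → ℚ) : Prop where
  nonneg : ∀ y z, 0 ≤ ℓ y z
  eq_zero_iff : ∀ y z, ℓ y z = 0 ↔ y = z
  symm : ∀ y z, ℓ y z = ℓ z y
  triangle : ∀ x y z, ℓ x z ≤ ℓ x y + ℓ y z
  precise : ∀ y z, ℓ y z ∈ PreciseRat lam

/-- The probability mass functions on `{0,1}^d` with all values in `PreciseRat lam`. -/
def PreciseDist (d lam : ℕ) : Set (Cube d → ℚ) :=
  {Q | (∀ x, 0 ≤ Q x) ∧ ∑ x, Q x = 1 ∧ ∀ x, Q x ∈ PreciseRat lam}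

/-- The metric loss: the expectation of `ℓ (f x) (h x)` for `x` drawn from the mass function `Q`. -/
def loss {Y : Type*} {d : ℕ} (ℓ : Y → Y → ℚ) (Q : Cube d → ℚ) (f h : Cube d → Y) : ℚ :=
  ∑ x, Q x * ℓ (f x) (h x)

/-! ### Interaction -/

/-- A message between the verifier and a prover: `len` bits, read as a number `val < 2 ^ len`. -/
structure Message where
  prover : Bool
  fromProver : Bool
  len : ℕ
  val : ℕ

/-- All messages sent so far, the most recent one first. -/
abbrev Transcript : Type := List Message

/-- The messages that were exchanged with prover `p`. -/
def Transcript.view (T : Transcript) (p : Bool) : Transcript := T.filter (fun e => e.prover == p)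

/-- The number of bits sent; every message is charged one extra bit, so that empty messages are
not free. -/
def Transcript.bits (T : Transcript) : ℕ := (T.map (fun e => e.len + 1)).sum

/-- A deterministic strategy of a prover, unbounded in computing power: its next message, as a
function of the messages it has seen.  If the verifier awaits `n` bits, it receives the `n`
low-order bits of this number. -/
abbrev Strategy : Type := Transcript → ℕ

/-! ### The verifier's machine

The verifier is a program for a random access machine.  It has memory cells `0, 1, 2, …` that hold
natural numbers (with indirect addressing), and a second bank of cells for elements of the range
`Y`.  Elements of `Y` are obtained by queries only, and are used only as arguments of the metric.
An operation on numbers takes unit time if its result fits into a machine word, and time the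
bit length of the result otherwise. -/

/-- Arithmetic expressions; `load e` is the content of the memory cell with address `e`. -/
inductive Expr where
  | const (n : ℕ)
  | load (e : Expr)
  | add (e₁ e₂ : Expr)
  | sub (e₁ e₂ : Expr)
  | mul (e₁ e₂ : Expr)
  | div (e₁ e₂ : Expr)
  | mod (e₁ e₂ : Expr)
  | shl (e₁ e₂ : Expr)
  | shr (e₁ e₂ : Expr)

/-- The value of an expression when the memory is `m`. -/
def Expr.eval (m : ℕ → ℕ) : Expr → ℕ
  | const n => n
  | load e => m (e.eval m)
  | add e₁ e₂ => e₁.eval m + e₂.eval m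
  | sub e₁ e₂ => e₁.eval m - e₂.eval m
  | mul e₁ e₂ => e₁.eval m * e₂.eval m
  | div e₁ e₂ => e₁.eval m / e₂.eval m
  | mod e₁ e₂ => e₁.eval m % e₂.eval m
  | shl e₁ e₂ => e₁.eval m * 2 ^ e₂.eval m
  | shr e₁ e₂ => e₁.eval m / 2 ^ e₂.eval m

/-- The time for handling the number `n` on a machine with `w`-bit words. -/
def numCost (w n : ℕ) : ℕ := if Nat.size n ≤ w then 1 else Nat.size n

/-- The time for evaluating an expression: every subexpression, in particular every operand and
every address, is charged for its value. -/
def Expr.cost (w : ℕ) (m : ℕ → ℕ) : Expr → ℕ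
  | const n => numCost w n
  | load e => e.cost w m + numCost w (m (e.eval m))
  | add e₁ e₂ => e₁.cost w m + e₂.cost w m + numCost w ((add e₁ e₂).eval m)
  | sub e₁ e₂ => e₁.cost w m + e₂.cost w m + numCost w ((sub e₁ e₂).eval m)
  | mul e₁ e₂ => e₁.cost w m + e₂.cost w m + numCost w ((mul e₁ e₂).eval m)
  | div e₁ e₂ => e₁.cost w m + e₂.cost w m + numCost w ((div e₁ e₂).eval m)
  | mod e₁ e₂ => e₁.cost w m + e₂.cost w m + numCost w ((mod e₁ e₂).eval m)
  | shl e₁ e₂ => e₁.cost w m + e₂.cost w m + numCost w ((shl e₁ e₂).eval m)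
  | shr e₁ e₂ => e₁.cost w m + e₂.cost w m + numCost w ((shr e₁ e₂).eval m)

/-- Programs of the verifier. -/
inductive Prog where
  | skip
  | seq (c₁ c₂ : Prog)
  /-- store the value `v` in memory cell `a` -/
  | assign (a v : Expr)
  /-- if `e₁ < e₂` then `c₁` else `c₂` -/
  | ifLt (e₁ e₂ : Expr) (c₁ c₂ : Prog)
  /-- while `e₁ < e₂` do `c` -/
  | whileLt (e₁ e₂ : Expr) (c : Prog)
  /-- toss `n` fair coins and store the outcome, a number below `2 ^ n`, in memory cell `a` -/
  | toss (a n : Expr)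
  /-- send the `n` low-order bits of `v` to prover `p` -/
  | send (p : Bool) (n v : Expr)
  /-- receive `n` bits from prover `p` and store them in memory cell `a` -/
  | receive (p : Bool) (a n : Expr)
  /-- query the ground truth `f` at the point encoded by `x`; store the answer in `Y`-cell `j` -/
  | queryTarget (j x : Expr)
  /-- query the hypothesis `h_s` at the point encoded by `x`; store the answer in `Y`-cell `j` -/
  | queryHyp (s : Bool) (j x : Expr)
  /-- query the mass function at the point encoded by `x`; store numerator and denominator of the
  answer in memory cells `a` and `a + 1` -/
  | queryMass (a x : Expr)
  /-- apply the metric to the contents of the `Y`-cells `i` and `j`; store numerator and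
  denominator of the result in memory cells `a` and `a + 1` -/
  | metric (a i j : Expr)

/-- Everything outside the verifier's program that determines its run. -/
structure Env (Y : Type*) (d : ℕ) where
  ℓ : Y → Y → ℚ
  Q : Cube d → ℚ
  f : Cube d → Y
  h : Bool → Cube d → Y
  /-- the next message of each prover, given all messages sent so far -/
  reply : Bool → Strategy
  /-- the verifier's coins -/
  coins : ℕ → Bool
  /-- the word size -/
  w : ℕ

/-- A configuration of the verifier, with the resources used so far. -/
structure State (Y : Type*) where
  mem : ℕ → ℕ
  reg : ℕ → Option Y
  transcript : Transcript
  coinsUsed : ℕ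
  time : ℕ
  targetQueries : ℕ

/-- The point of `{0,1}^d` encoded by a number: its `d` low-order bits. -/
def point (d n : ℕ) : Cube d := fun i => n.testBit i

/-- The metric on the contents of two `Y`-cells (`0` if one of them is still empty). -/
def metricVal {Y : Type*} (ℓ : Y → Y → ℚ) : Option Y → Option Y → ℚ
  | some y, some z => ℓ y z
  | _, _ => 0

/-- Store numerator and denominator of the nonnegative rational `r` in the cells `a`, `a + 1`. -/
def storeRat (m : ℕ → ℕ) (a : ℕ) (r : ℚ) : ℕ → ℕ :=
  Function.update (Function.update m a r.num.toNat) (a + 1) r.den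

/-- The time for handling the nonnegative rational `r`. -/
def ratCost (w : ℕ) (r : ℚ) : ℕ := numCost w r.num.toNat + numCost w r.den

/-- `Exec E c s t`: the program `c`, started in configuration `s`, halts in configuration `t`. -/
inductive Exec {Y : Type*} {d : ℕ} (E : Env Y d) : Prog → State Y → State Y → Prop where
  | skip (s : State Y) : Exec E .skip s { s with time := s.time + 1 }
  | seq {c₁ c₂ : Prog} {s t u : State Y} :
      Exec E c₁ s t → Exec E c₂ t u → Exec E (.seq c₁ c₂) s u
  | assign (a v : Expr) (s : State Y) :
      Exec E (.assign a v) s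
        { s with
          mem := Function.update s.mem (a.eval s.mem) (v.eval s.mem)
          time := s.time + (a.cost E.w s.mem + v.cost E.w s.mem + 1) }
  | ifTrue {e₁ e₂ : Expr} {c₁ c₂ : Prog} {s t : State Y} :
      e₁.eval s.mem < e₂.eval s.mem →
      Exec E c₁ { s with time := s.time + (e₁.cost E.w s.mem + e₂.cost E.w s.mem + 1) } t →
      Exec E (.ifLt e₁ e₂ c₁ c₂) s t
  | ifFalse {e₁ e₂ : Expr} {c₁ c₂ : Prog} {s t : State Y} :
      ¬ e₁.eval s.mem < e₂.eval s.mem →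
      Exec E c₂ { s with time := s.time + (e₁.cost E.w s.mem + e₂.cost E.w s.mem + 1) } t →
      Exec E (.ifLt e₁ e₂ c₁ c₂) s t
  | whileDone {e₁ e₂ : Expr} {c : Prog} {s : State Y} :
      ¬ e₁.eval s.mem < e₂.eval s.mem →
      Exec E (.whileLt e₁ e₂ c) s
        { s with time := s.time + (e₁.cost E.w s.mem + e₂.cost E.w s.mem + 1) }
  | whileStep {e₁ e₂ : Expr} {c : Prog} {s t u : State Y} :
      e₁.eval s.mem < e₂.eval s.mem →
      Exec E c { s with time := s.time + (e₁.cost E.w s.mem + e₂.cost E.w s.mem + 1) } t →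
      Exec E (.whileLt e₁ e₂ c) t u →
      Exec E (.whileLt e₁ e₂ c) s u
  | toss (a n : Expr) (s : State Y) :
      Exec E (.toss a n) s
        { s with
          mem := Function.update s.mem (a.eval s.mem)
            (Nat.ofBits fun i : Fin (n.eval s.mem) => E.coins (s.coinsUsed + i))
          coinsUsed := s.coinsUsed + n.eval s.mem
          time := s.time + (a.cost E.w s.mem + n.cost E.w s.mem + n.eval s.mem + 1) }
  | send (p : Bool) (n v : Expr) (s : State Y) :
      Exec E (.send p n v) s
        { s with
          transcript :=
            ⟨p, false, n.eval s.mem, v.eval s.mem % 2 ^ n.eval s.mem⟩ :: s.transcript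
          time := s.time + (n.cost E.w s.mem + v.cost E.w s.mem + n.eval s.mem + 1) }
  | receive (p : Bool) (a n : Expr) (s : State Y) :
      Exec E (.receive p a n) s
        { s with
          mem := Function.update s.mem (a.eval s.mem)
            (E.reply p s.transcript % 2 ^ n.eval s.mem)
          transcript :=
            ⟨p, true, n.eval s.mem, E.reply p s.transcript % 2 ^ n.eval s.mem⟩ :: s.transcript
          time := s.time + (a.cost E.w s.mem + n.cost E.w s.mem + n.eval s.mem + 1) }
  | queryTarget (j x : Expr) (s : State Y) :
      Exec E (.queryTarget j x) s
        { s with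
          reg := Function.update s.reg (j.eval s.mem) (some (E.f (point d (x.eval s.mem))))
          targetQueries := s.targetQueries + 1
          time := s.time + (j.cost E.w s.mem + x.cost E.w s.mem + d + 1) }
  | queryHyp (b : Bool) (j x : Expr) (s : State Y) :
      Exec E (.queryHyp b j x) s
        { s with
          reg := Function.update s.reg (j.eval s.mem) (some (E.h b (point d (x.eval s.mem))))
          time := s.time + (j.cost E.w s.mem + x.cost E.w s.mem + d + 1) }
  | queryMass (a x : Expr) (s : State Y) :
      Exec E (.queryMass a x) s
        { s with
          mem := storeRat s.mem (a.eval s.mem) (E.Q (point d (x.eval s.mem)))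
          time := s.time + (a.cost E.w s.mem + x.cost E.w s.mem + d + 1
            + ratCost E.w (E.Q (point d (x.eval s.mem)))) }
  | metric (a i j : Expr) (s : State Y) :
      Exec E (.metric a i j) s
        { s with
          mem := storeRat s.mem (a.eval s.mem)
            (metricVal E.ℓ (s.reg (i.eval s.mem)) (s.reg (j.eval s.mem)))
          time := s.time + (a.cost E.w s.mem + i.cost E.w s.mem + j.cost E.w s.mem + 1
            + ratCost E.w (metricVal E.ℓ (s.reg (i.eval s.mem)) (s.reg (j.eval s.mem)))) }

/-- A run is determined by its environment, including the coins. -/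
theorem Exec.unique {Y : Type*} {d : ℕ} {E : Env Y d} {c : Prog} {s t u : State Y}
    (ht : Exec E c s t) (hu : Exec E c s u) : t = u := by
  induction ht generalizing u with
  | seq _ _ ih₁ ih₂ =>
    cases hu with
    | seq h₁ h₂ =>
      cases ih₁ h₁
      exact ih₂ h₂
  | ifTrue hlt _ ih =>
    cases hu with
    | ifTrue _ h => exact ih h
    | ifFalse hn _ => exact absurd hlt hn
  | ifFalse hn _ ih =>
    cases hu with
    | ifTrue hlt _ => exact absurd hlt hn
    | ifFalse _ h => exact ih h
  | whileDone hn =>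
    cases hu with
    | whileDone _ => rfl
    | whileStep hlt _ _ => exact absurd hlt hn
  | whileStep hlt _ _ ih₁ ih₂ =>
    cases hu with
    | whileDone hn => exact absurd hlt hn
    | whileStep _ h₁ h₂ =>
      cases ih₁ h₁
      exact ih₂ h₂
  | _ =>
    cases hu
    rfl

/-! ### Protocols -/

/-- The common input of all parties: the dimension, and the real parameters `ε` and `β` in the
finite form `⌈1/ε⌉` and `⌈log₂ (1/β)⌉`. -/
structure Input where
  d : ℕ
  invEps : ℕ
  logInvBeta : ℕ

/-- The input that presents the dimension `d` and the reals `ε, β > 0`. -/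
noncomputable def Input.of (d : ℕ) (ε β : ℝ) : Input where
  d := d
  invEps := ⌈1 / ε⌉₊
  logInvBeta := ⌈Real.logb 2 (1 / β)⌉₊

/-- A protocol: the verifier's program, and the two honest provers.  An honest prover knows the
input, the hypotheses and the mass function of the distribution, but not the ground truth, and
sees only the messages on its own channel. -/
structure Protocol (Y : Type*) where
  verifier : Prog
  prover : Bool → (I : Input) → (h : Bool → Cube I.d → Y) → (Q : Cube I.d → ℚ) → Strategy

/-- The verifier starts with the input in the memory cells `0, 1, 2`; all else is empty. -/
def initial (Y : Type*) (I : Input) : State Y where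
  mem := fun i => if i = 0 then I.d else if i = 1 then I.invEps
    else if i = 2 then I.logInvBeta else 0
  reg := fun _ => none
  transcript := []
  coinsUsed := 0
  time := 0
  targetQueries := 0

/-- The output bit of the verifier: whether memory cell `0` is nonzero. -/
def State.output {Y : Type*} (s : State Y) : Bool := s.mem 0 != 0

/-- `P.Run w ℓ I Q f h b adv ω s`: on input `I`, in the interaction of the honest prover `b`, the
malicious prover `1 - b` playing the strategy `adv`, and the verifier with coins `ω`, the verifier
halts in configuration `s`.  The malicious prover sees all messages, on both channels. -/
def Protocol.Run {Y : Type*} (P : Protocol Y) (w : ℕ) (ℓ : Y → Y → ℚ) (I : Input)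
    (Q : Cube I.d → ℚ) (f : Cube I.d → Y) (h : Bool → Cube I.d → Y) (b : Bool) (adv : Strategy)
    (ω : ℕ → Bool) (s : State Y) : Prop :=
  Exec
    { ℓ := ℓ, Q := Q, f := f, h := h, coins := ω, w := w
      reply := fun p T => if p = b then P.prover b I h Q (T.view b) else adv T }
    P.verifier (initial Y I) s

/-- The law of an infinite sequence of independent fair coins. -/
noncomputable def coinLaw : MeasureTheory.Measure (ℕ → Bool) :=
  MeasureTheory.Measure.infinitePi fun _ => (PMF.uniformOfFintype Bool).toMeasure

/-- On input `I`, `P` is an `(α, β)`-refereed learning protocol for the hypothesis class `H` and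
the family `𝒟` of distributions, with respect to `ℓ`: if one prover is honest then, whatever the
other one does, the verifier halts with probability at least `1 - β` with a hypothesis whose loss
is at most `α` times the smaller one of the two losses. -/
def Protocol.IsRefereed {Y : Type*} (P : Protocol Y) (w : ℕ) (ℓ : Y → Y → ℚ) (I : Input)
    (α β : ℝ) (H : Set (Cube I.d → Y)) (𝒟 : Set (Cube I.d → ℚ)) : Prop :=
  ∀ Q ∈ 𝒟, ∀ (f : Cube I.d → Y) (h : Bool → Cube I.d → Y), (∀ b, h b ∈ H) →
    ∀ (b : Bool) (adv : Strategy),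
      ENNReal.ofReal (1 - β) ≤ coinLaw {ω | ∃ s, P.Run w ℓ I Q f h b adv ω s ∧
        (loss ℓ Q f (h s.output) : ℝ) ≤
          α * min (loss ℓ Q f (h false) : ℝ) (loss ℓ Q f (h true) : ℝ)}

/-- If one prover is honest then, whatever the other one does and whatever the coins are, the
verifier halts after at most `time` steps, at most `comm` bits have been sent, and the verifier has
made at most `queries` queries to the ground truth. -/
def Protocol.HasComplexity {Y : Type*} (P : Protocol Y) (w : ℕ) (ℓ : Y → Y → ℚ) (I : Input)
    (H : Set (Cube I.d → Y)) (𝒟 : Set (Cube I.d → ℚ)) (time comm queries : ℝ) : Prop :=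
  ∀ Q ∈ 𝒟, ∀ (f : Cube I.d → Y) (h : Bool → Cube I.d → Y), (∀ b, h b ∈ H) →
    ∀ (b : Bool) (adv : Strategy) (ω : ℕ → Bool), ∃ s, P.Run w ℓ I Q f h b adv ω s ∧
      (s.time : ℝ) ≤ time ∧ (s.transcript.bits : ℝ) ≤ comm ∧ (s.targetQueries : ℝ) ≤ queries

/-- A machine word holds `c` times as many bits as the sum of the parameters. -/
def wordSize (c lam : ℕ) (I : Input) : ℕ :=
  c * Nat.size (I.d + lam + I.invEps + I.logInvBeta)

/-- `λ (1 + 1/ε²) log (1 + 1/ε) log (1/β)`, where the factors `λ` and the two logarithms are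
replaced by `1` if they are smaller. -/
noncomputable def costFactor (lam : ℕ) (ε β : ℝ) : ℝ :=
  max 1 (lam : ℝ) * (1 + 1 / ε ^ 2) * max 1 (Real.log (1 + 1 / ε)) * max 1 (Real.log (1 / β))

end RefereedLearning

/-! Write `D x` for the distance of the two hypotheses at `x`, `Z` for the mean of `D` under `Q`,
and `L₀`, `L₁` for the two losses. Where `D x > 0`, the ratio `(ℓ (f x) (h false x) + D x - ℓ (f x)
(h true x)) / D x` lies in `[0, 2]` by the triangle inequality. If `x` is drawn with probability `Q
x * D x / Z`, its mean is `1 + (L₀ - L₁) / Z`. Since `Z ≤ L₀ + L₁`, this mean is below `1/2` if `L₁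
> 3 L₀` and above `3/2` if `L₀ > 3 L₁`. So `O(log (1/β))` samples, hence as many queries to `f`,
tell these cases apart, and in all other cases either output is acceptable. The factor reached is
`3` itself; `ε` is only slack. The verifier works with the integer score `⌊4 · ratio⌋` in `{0, …,
8}` and the threshold `4` (`score_bounds`, `score_le_of_loss_lt`, `score_ge_of_loss_lt`,
`chernoff`).

The verifier cannot compute `Z`, a sum over `2 ^ d` points. It uses the integer weights `⌊2 ^ (2 *
lam + 7) * Q x * D x⌋` and delegates their prefix sums. A sample is then found by inverting the
cumulative weight with a binary search. Nonzero masses and distances are at least `2 ^ -lam`, so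
rounding distorts the weights by a relative error of at most `1/128`, and finitely many coins by
another `1/128` (`weight_bounds`, `card_pick_mul_le`, `sum_pick_le`).

A prefix sum is asked of both provers, one of whom is honest. A second binary search runs between
the argument `0`, where the sum is known to be `0`, and an argument where the answers differ. It
ends at neighbouring arguments `x`, `x + 1` with a correct value at `x` and a disputed one at `x +
1`. Computing the single weight at `x`, which needs no query to `f`, exposes the liar
(`runs_getWeight`). A sample thus takes at most `d` prefix sums with at most `d` rounds of bisection
each, on numbers of `O(lam + d)` bits.

For `β ≥ 1/2` a single coin is tossed and `f` is not queried; this is forced by a query bound that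
vanishes as `β` tends to `1`. -/

namespace RefereedLearning

/-! ### Total correctness of programs with a time bound -/

/-- The content of the memory cell `k`. -/
def cell (k : ℕ) : Expr := .load (.const k)

@[simp] theorem cell_eval (m : ℕ → ℕ) (k : ℕ) : (cell k).eval m = m k := rfl

/-- The number of nodes of an expression. -/
def Expr.nodes : Expr → ℕ
  | const _ => 1
  | load e => e.nodes + 1
  | add e₁ e₂ | sub e₁ e₂ | mul e₁ e₂ | div e₁ e₂ | mod e₁ e₂ | shl e₁ e₂ | shr e₁ e₂ =>
    e₁.nodes + e₂.nodes + 1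

@[simp] theorem cell_nodes (k : ℕ) : (cell k).nodes = 2 := rfl

/-- Handling any of the numbers that occur in the evaluation of an expression takes time at
most `H`. -/
def Expr.Cheap (w H : ℕ) (m : ℕ → ℕ) : Expr → Prop
  | const n => numCost w n ≤ H
  | load e => e.Cheap w H m ∧ numCost w (m (e.eval m)) ≤ H
  | add e₁ e₂ => e₁.Cheap w H m ∧ e₂.Cheap w H m ∧ numCost w (e₁.eval m + e₂.eval m) ≤ H
  | sub e₁ e₂ => e₁.Cheap w H m ∧ e₂.Cheap w H m ∧ numCost w (e₁.eval m - e₂.eval m) ≤ H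
  | mul e₁ e₂ => e₁.Cheap w H m ∧ e₂.Cheap w H m ∧ numCost w (e₁.eval m * e₂.eval m) ≤ H
  | div e₁ e₂ => e₁.Cheap w H m ∧ e₂.Cheap w H m ∧ numCost w (e₁.eval m / e₂.eval m) ≤ H
  | mod e₁ e₂ => e₁.Cheap w H m ∧ e₂.Cheap w H m ∧ numCost w (e₁.eval m % e₂.eval m) ≤ H
  | shl e₁ e₂ => e₁.Cheap w H m ∧ e₂.Cheap w H m ∧ numCost w (e₁.eval m * 2 ^ e₂.eval m) ≤ H
  | shr e₁ e₂ => e₁.Cheap w H m ∧ e₂.Cheap w H m ∧ numCost w (e₁.eval m / 2 ^ e₂.eval m) ≤ H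

@[simp] theorem cell_cheap (w H : ℕ) (m : ℕ → ℕ) (k : ℕ) :
    (cell k).Cheap w H m ↔ numCost w k ≤ H ∧ numCost w (m k) ≤ H := Iff.rfl

theorem Expr.Cheap.cost_le {w H : ℕ} {m : ℕ → ℕ} {e : Expr} (he : e.Cheap w H m) :
    e.cost w m ≤ e.nodes * H := by
  induction e with
  | const n => simpa [Expr.nodes, Expr.cost, Expr.Cheap] using he
  | load e ih =>
    have := ih he.1
    have := he.2
    simp only [Expr.nodes, Expr.cost, add_mul, one_mul]
    omega
  | _ e₁ e₂ ih₁ ih₂ =>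
    have h₁ := ih₁ he.1
    have h₂ := ih₂ he.2.1
    have h₃ := he.2.2
    simp only [Expr.nodes, Expr.cost, Expr.eval, add_mul, one_mul]
    omega

theorem one_le_numCost (w n : ℕ) : 1 ≤ numCost w n := by
  unfold numCost
  split_ifs with h <;> omega

theorem numCost_le_of_lt {w H v : ℕ} (hH : 1 ≤ H) (hv : v < 2 ^ H) : numCost w v ≤ H := by
  unfold numCost
  split_ifs
  · exact hH
  · exact Nat.size_le.2 hv

theorem numCost_le_of_word {w H v : ℕ} (hH : 1 ≤ H) (hv : Nat.size v ≤ w) : numCost w v ≤ H := by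
  simpa [numCost, hv] using hH

variable {Y : Type*} {d : ℕ} {E : Env Y d}

/-- The program `c`, started in `s`, halts in a configuration that satisfies `Post`. -/
def Runs (E : Env Y d) (c : Prog) (s : State Y) (Post : State Y → Prop) : Prop :=
  ∃ t, Exec E c s t ∧ Post t

/-! ### Hoare rules in which every number handled costs at most `H`. -/

namespace Runs

variable {s : State Y} {Post : State Y → Prop} {H : ℕ}

theorem skip (h : Post { s with time := s.time + 1 }) : Runs E .skip s Post :=
  ⟨_, .skip s, h⟩

theorem seq {c₁ c₂ : Prog} (h : Runs E c₁ s fun t => Runs E c₂ t Post) :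
    Runs E (.seq c₁ c₂) s Post :=
  let ⟨_, h₁, u, h₂, hp⟩ := h
  ⟨u, .seq h₁ h₂, hp⟩

theorem assign {k : ℕ} {v : Expr} (hk : numCost E.w k ≤ H) (hv : v.Cheap E.w H s.mem)
    (h : ∀ τ ≤ s.time + (v.nodes + 2) * H,
      Post { s with mem := Function.update s.mem k (v.eval s.mem), time := τ }) :
    Runs E (.assign (.const k) v) s Post := by
  refine ⟨_, .assign (.const k) v s, h _ ?_⟩
  have h₁ := hv.cost_le
  have h₂ := one_le_numCost E.w k
  simp only [Expr.cost, add_mul]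
  omega

theorem ifLt {e₁ e₂ : Expr} {c₁ c₂ : Prog} (hH : 1 ≤ H) (h₁ : e₁.Cheap E.w H s.mem)
    (h₂ : e₂.Cheap E.w H s.mem)
    (hT : e₁.eval s.mem < e₂.eval s.mem → ∀ τ ≤ s.time + (e₁.nodes + e₂.nodes + 1) * H,
      Runs E c₁ { s with time := τ } Post)
    (hF : ¬ e₁.eval s.mem < e₂.eval s.mem → ∀ τ ≤ s.time + (e₁.nodes + e₂.nodes + 1) * H,
      Runs E c₂ { s with time := τ } Post) :
    Runs E (.ifLt e₁ e₂ c₁ c₂) s Post := by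
  have h₁ := h₁.cost_le
  have h₂ := h₂.cost_le
  have hle : s.time + (e₁.cost E.w s.mem + e₂.cost E.w s.mem + 1) ≤
      s.time + (e₁.nodes + e₂.nodes + 1) * H := by
    simp only [add_mul]
    omega
  by_cases hlt : e₁.eval s.mem < e₂.eval s.mem
  · obtain ⟨t, ht, hp⟩ := hT hlt _ hle
    exact ⟨t, .ifTrue hlt ht, hp⟩
  · obtain ⟨t, ht, hp⟩ := hF hlt _ hle
    exact ⟨t, .ifFalse hlt ht, hp⟩

/-- The rule for loops: `Inv k` holds before a pass if at most `k` passes are still to come. -/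
theorem whileLt {e₁ e₂ : Expr} {c : Prog} (Inv : ℕ → State Y → Prop) (hH : 1 ≤ H)
    (hcheap : ∀ k s, Inv k s → e₁.Cheap E.w H s.mem ∧ e₂.Cheap E.w H s.mem)
    (hzero : ∀ s, Inv 0 s → ¬ e₁.eval s.mem < e₂.eval s.mem)
    (hstep : ∀ k s, Inv (k + 1) s → e₁.eval s.mem < e₂.eval s.mem →
      ∀ τ ≤ s.time + (e₁.nodes + e₂.nodes + 1) * H, Runs E c { s with time := τ } (Inv k))
    (hdone : ∀ k s, Inv k s → ¬ e₁.eval s.mem < e₂.eval s.mem →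
      ∀ τ ≤ s.time + (e₁.nodes + e₂.nodes + 1) * H, Post { s with time := τ })
    (k : ℕ) (hs : Inv k s) : Runs E (.whileLt e₁ e₂ c) s Post := by
  have hle : ∀ k s, Inv k s → s.time + (e₁.cost E.w s.mem + e₂.cost E.w s.mem + 1) ≤
      s.time + (e₁.nodes + e₂.nodes + 1) * H := by
    intro k s hs
    have h₁ := (hcheap k s hs).1.cost_le
    have h₂ := (hcheap k s hs).2.cost_le
    simp only [add_mul]
    omega
  induction k generalizing s with
  | zero => exact ⟨_, .whileDone (hzero s hs), hdone _ s hs (hzero s hs) _ (hle _ s hs)⟩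
  | succ k ih =>
    by_cases hlt : e₁.eval s.mem < e₂.eval s.mem
    · obtain ⟨t, ht, hp⟩ := hstep k s hs hlt _ (hle _ s hs)
      obtain ⟨u, hu, hq⟩ := ih hp
      exact ⟨u, .whileStep hlt ht hu, hq⟩
    · exact ⟨_, .whileDone hlt, hdone _ s hs hlt _ (hle _ s hs)⟩

theorem toss {k N : ℕ} {n : Expr} (hN : n.eval s.mem = N) (hk : numCost E.w k ≤ H)
    (hn : n.Cheap E.w H s.mem)
    (h : ∀ τ ≤ s.time + (n.nodes + 2) * H + N,
      Post { s with
        mem := Function.update s.mem k (Nat.ofBits fun i : Fin N => E.coins (s.coinsUsed + i))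
        coinsUsed := s.coinsUsed + N
        time := τ }) :
    Runs E (.toss (.const k) n) s Post := by
  subst hN
  refine ⟨_, .toss (.const k) n s, h _ ?_⟩
  have h₁ := hn.cost_le
  have h₂ := one_le_numCost E.w k
  simp only [Expr.cost, add_mul]
  omega

theorem send {p : Bool} {n v : Expr} (hH : 1 ≤ H) (hn : n.Cheap E.w H s.mem)
    (hv : v.Cheap E.w H s.mem)
    (h : ∀ τ ≤ s.time + (n.nodes + v.nodes + 1) * H + n.eval s.mem,
      Post { s with
        transcript := ⟨p, false, n.eval s.mem, v.eval s.mem % 2 ^ n.eval s.mem⟩ :: s.transcript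
        time := τ }) :
    Runs E (.send p n v) s Post := by
  refine ⟨_, .send p n v s, h _ ?_⟩
  have h₁ := hn.cost_le
  have h₂ := hv.cost_le
  simp only [add_mul]
  omega

theorem receive {p : Bool} {k : ℕ} {n : Expr} (hk : numCost E.w k ≤ H)
    (hn : n.Cheap E.w H s.mem)
    (h : ∀ τ ≤ s.time + (n.nodes + 2) * H + n.eval s.mem,
      Post { s with
        mem := Function.update s.mem k (E.reply p s.transcript % 2 ^ n.eval s.mem)
        transcript :=
          ⟨p, true, n.eval s.mem, E.reply p s.transcript % 2 ^ n.eval s.mem⟩ :: s.transcript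
        time := τ }) :
    Runs E (.receive p (.const k) n) s Post := by
  refine ⟨_, .receive p (.const k) n s, h _ ?_⟩
  have h₁ := hn.cost_le
  have h₂ := one_le_numCost E.w k
  simp only [Expr.cost, add_mul]
  omega

theorem queryTarget {j : ℕ} {x : Expr} (hj : numCost E.w j ≤ H) (hx : x.Cheap E.w H s.mem)
    (h : ∀ τ ≤ s.time + (x.nodes + 2) * H + d,
      Post { s with
        reg := Function.update s.reg j (some (E.f (point d (x.eval s.mem))))
        targetQueries := s.targetQueries + 1
        time := τ }) :
    Runs E (.queryTarget (.const j) x) s Post := by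
  refine ⟨_, .queryTarget (.const j) x s, h _ ?_⟩
  have h₁ := hx.cost_le
  have h₂ := one_le_numCost E.w j
  simp only [Expr.cost, add_mul]
  omega

theorem queryHyp {b : Bool} {j : ℕ} {x : Expr} (hj : numCost E.w j ≤ H)
    (hx : x.Cheap E.w H s.mem)
    (h : ∀ τ ≤ s.time + (x.nodes + 2) * H + d,
      Post { s with
        reg := Function.update s.reg j (some (E.h b (point d (x.eval s.mem))))
        time := τ }) :
    Runs E (.queryHyp b (.const j) x) s Post := by
  refine ⟨_, .queryHyp b (.const j) x s, h _ ?_⟩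
  have h₁ := hx.cost_le
  have h₂ := one_le_numCost E.w j
  simp only [Expr.cost, add_mul]
  omega

theorem queryMass {k : ℕ} {x : Expr} {r : ℚ} (hk : numCost E.w k ≤ H)
    (hx : x.Cheap E.w H s.mem) (hr : E.Q (point d (x.eval s.mem)) = r)
    (hnum : numCost E.w r.num.toNat ≤ H) (hden : numCost E.w r.den ≤ H)
    (h : ∀ τ ≤ s.time + (x.nodes + 4) * H + d,
      Post { s with mem := storeRat s.mem k r, time := τ }) :
    Runs E (.queryMass (.const k) x) s Post := by
  subst hr
  refine ⟨_, .queryMass (.const k) x s, h _ ?_⟩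
  have h₁ := hx.cost_le
  have h₂ := one_le_numCost E.w k
  simp only [Expr.cost, ratCost, add_mul]
  omega

theorem metric {k i j : ℕ} {r : ℚ} (hk : numCost E.w k ≤ H) (hi : numCost E.w i ≤ H)
    (hj : numCost E.w j ≤ H) (hr : metricVal E.ℓ (s.reg i) (s.reg j) = r)
    (hnum : numCost E.w r.num.toNat ≤ H) (hden : numCost E.w r.den ≤ H)
    (h : ∀ τ ≤ s.time + 6 * H, Post { s with mem := storeRat s.mem k r, time := τ }) :
    Runs E (.metric (.const k) (.const i) (.const j)) s Post := by
  subst hr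
  refine ⟨_, .metric (.const k) (.const i) (.const j) s, h _ ?_⟩
  have h₂ := one_le_numCost E.w k
  simp only [Expr.cost, Expr.eval, ratCost]
  omega

end Runs

/-- Communication is charged for in the running time. -/
theorem Exec.bits_le {c : Prog} {s t : State Y} (h : Exec E c s t) :
    t.transcript.bits + s.time ≤ s.transcript.bits + t.time := by
  induction h with
  | seq _ _ ih₁ ih₂ => omega
  | ifTrue _ _ ih => dsimp only at ih; omega
  | ifFalse _ _ ih => dsimp only at ih; omega
  | whileStep _ _ _ ih₁ ih₂ => dsimp only at ih₁; omega
  | send _ _ _ _ => simp only [Transcript.bits, List.map_cons, List.sum_cons]; omega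
  | receive _ _ _ _ => simp only [Transcript.bits, List.map_cons, List.sum_cons]; omega
  | _ => dsimp only; omega

end RefereedLearning

namespace RefereedLearning

/-! ### Rounded weights -/

section Weights

variable {Y : Type*} {d : ℕ}

theorem PreciseRat.num_den_le {lam : ℕ} {r : ℚ} (hr : r ∈ PreciseRat lam) :
    r.num.toNat ≤ 2 ^ lam ∧ r.den ≤ 2 ^ lam := by
  obtain ⟨p, q, hq, hp, hq', rfl⟩ := hr
  constructor
  · by_cases hp0 : p = 0
    · simp [hp0]
    · have h₁ : ((p : ℚ) / q).num ∣ p :=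
        Rat.divInt_eq_div p q ▸ Rat.num_dvd p hq
      have h₂ : ((p : ℚ) / q).num ≤ |p| := Int.le_of_dvd (abs_pos.2 hp0) ((dvd_abs _ _).2 h₁)
      have h₃ : ((p : ℚ) / q).num ≤ ((2 ^ lam : ℕ) : ℤ) := by
        push_cast
        exact h₂.trans hp
      exact Int.toNat_le.2 h₃
  · have h₁ : (((p : ℚ) / q).den : ℤ) ∣ q := by
      simpa only [Rat.divInt_eq_div] using Rat.den_dvd p q
    have h₂ : (((p : ℚ) / q).den : ℤ) ≤ |q| := Int.le_of_dvd (abs_pos.2 hq) ((dvd_abs _ _).2 h₁)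
    have h₃ : (((p : ℚ) / q).den : ℤ) ≤ ((2 ^ lam : ℕ) : ℤ) := by
      push_cast
      exact h₂.trans hq'
    exact_mod_cast h₃

/-- The mass times the distance of the two hypotheses, at the point encoded by `x`, in units of
`2 ^ -(2 * lam + 7)` and rounded down. -/
def weight (lam : ℕ) (ℓ : Y → Y → ℚ) (h : Bool → Cube d → Y) (Q : Cube d → ℚ) (x : ℕ) : ℕ :=
  (Q (point d x)).num.toNat * (ℓ (h false (point d x)) (h true (point d x))).num.toNat
      * 2 ^ (2 * lam + 7) /
    ((Q (point d x)).den * (ℓ (h false (point d x)) (h true (point d x))).den)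

/-- The weight of the points encoded by the numbers below `n`. -/
def prefixWeight (lam : ℕ) (ℓ : Y → Y → ℚ) (h : Bool → Cube d → Y) (Q : Cube d → ℚ) (n : ℕ) : ℕ :=
  ∑ x ∈ Finset.range n, weight lam ℓ h Q x

/-- The number of bits of an answer of a prover. -/
def answerLen (lam d : ℕ) : ℕ := 4 * lam + d + 8

/-- The number of coins for one sample. -/
def coinLen (lam d : ℕ) : ℕ := 4 * lam + d + 15

/-- The point that is sampled with the coins `r`. -/
def pick (lam : ℕ) (ℓ : Y → Y → ℚ) (h : Bool → Cube d → Y) (Q : Cube d → ℚ) (r : ℕ) : ℕ :=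
  Nat.findGreatest (fun x => prefixWeight lam ℓ h Q x * 2 ^ coinLen lam d ≤
    r * prefixWeight lam ℓ h Q (2 ^ d)) (2 ^ d - 1)

/-- The vote, between `0` and `8`, that a sample casts against the hypothesis `h false`. -/
def score (ℓ : Y → Y → ℚ) (f : Cube d → Y) (h : Bool → Cube d → Y) (x : ℕ) : ℕ :=
  4 * ((ℓ (f (point d x)) (h false (point d x))).num.toNat *
          ((ℓ (f (point d x)) (h true (point d x))).den *
            (ℓ (h false (point d x)) (h true (point d x))).den) +
        (ℓ (h false (point d x)) (h true (point d x))).num.toNat *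
          ((ℓ (f (point d x)) (h false (point d x))).den *
            (ℓ (f (point d x)) (h true (point d x))).den) -
        (ℓ (f (point d x)) (h true (point d x))).num.toNat *
          ((ℓ (f (point d x)) (h false (point d x))).den *
            (ℓ (h false (point d x)) (h true (point d x))).den)) /
    ((ℓ (h false (point d x)) (h true (point d x))).num.toNat *
      ((ℓ (f (point d x)) (h false (point d x))).den *
        (ℓ (f (point d x)) (h true (point d x))).den))

variable {lam : ℕ} {ℓ : Y → Y → ℚ} {h : Bool → Cube d → Y} {Q : Cube d → ℚ}

theorem prefixWeight_zero : prefixWeight lam ℓ h Q 0 = 0 := by simp [prefixWeight]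

theorem prefixWeight_succ (n : ℕ) :
    prefixWeight lam ℓ h Q (n + 1) = prefixWeight lam ℓ h Q n + weight lam ℓ h Q n :=
  Finset.sum_range_succ _ _

theorem prefixWeight_mono {m n : ℕ} (hmn : m ≤ n) :
    prefixWeight lam ℓ h Q m ≤ prefixWeight lam ℓ h Q n :=
  Finset.sum_le_sum_of_subset (Finset.range_mono hmn)

theorem weight_numerator_le (hℓ : IsPreciseMetric lam ℓ) (hQ : Q ∈ PreciseDist d lam) (x : ℕ) :
    (Q (point d x)).num.toNat * (ℓ (h false (point d x)) (h true (point d x))).num.toNat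
      * 2 ^ (2 * lam + 7) ≤ 2 ^ (4 * lam + 7) := by
  have h₁ := (PreciseRat.num_den_le (hQ.2.2 (point d x))).1
  have h₂ := (PreciseRat.num_den_le (hℓ.precise (h false (point d x)) (h true (point d x)))).1
  calc _ ≤ 2 ^ lam * 2 ^ lam * 2 ^ (2 * lam + 7) := by gcongr
    _ = _ := by rw [← pow_add, ← pow_add]; congr 1; ring

/-- This fixes `answerLen`: a weight has numerator at most `2 ^ (lam + lam + (2 * lam + 7))`, and at
most `2 ^ d` of them are added. -/
theorem prefixWeight_lt (hℓ : IsPreciseMetric lam ℓ) (hQ : Q ∈ PreciseDist d lam) {n : ℕ}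
    (hn : n ≤ 2 ^ d) : prefixWeight lam ℓ h Q n < 2 ^ answerLen lam d := by
  have h₁ : ∀ x ∈ Finset.range n, weight lam ℓ h Q x ≤ 2 ^ (4 * lam + 7) := fun x _ =>
    (Nat.div_le_self _ _).trans (weight_numerator_le hℓ hQ x)
  calc prefixWeight lam ℓ h Q n ≤ n * 2 ^ (4 * lam + 7) := by
        simpa [prefixWeight] using Finset.sum_le_card_nsmul _ _ _ h₁
    _ ≤ 2 ^ d * 2 ^ (4 * lam + 7) := by gcongr
    _ = 2 ^ (4 * lam + d + 7) := by rw [← pow_add]; congr 1; ring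
    _ < 2 ^ answerLen lam d := Nat.pow_lt_pow_right (by norm_num) (by unfold answerLen; omega)

/-- The search interval `[x, x + 1)` determines the sampled point. -/
theorem eq_pick {r x : ℕ} (hx : x < 2 ^ d)
    (h₁ : prefixWeight lam ℓ h Q x * 2 ^ coinLen lam d ≤ r * prefixWeight lam ℓ h Q (2 ^ d))
    (h₂ : x + 1 = 2 ^ d ∨ r * prefixWeight lam ℓ h Q (2 ^ d) <
      prefixWeight lam ℓ h Q (x + 1) * 2 ^ coinLen lam d) : x = pick lam ℓ h Q r := by
  symm
  rw [pick, Nat.findGreatest_eq_iff]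
  refine ⟨by omega, fun _ => h₁, fun n hn hn' => ?_⟩
  rcases h₂ with h₂ | h₂
  · omega
  · have : prefixWeight lam ℓ h Q (x + 1) ≤ prefixWeight lam ℓ h Q n := prefixWeight_mono hn
    have := Nat.mul_le_mul_right (2 ^ coinLen lam d) this
    omega

theorem pick_lt (r : ℕ) : pick lam ℓ h Q r < 2 ^ d := by
  have := Nat.findGreatest_le (P := fun x => prefixWeight lam ℓ h Q x * 2 ^ coinLen lam d ≤
    r * prefixWeight lam ℓ h Q (2 ^ d)) (2 ^ d - 1)
  have : 0 < 2 ^ d := by positivity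
  unfold pick
  omega

/-- The alternative `pick + 1 = 2 ^ d` is needed because the predicate that defines `pick` is tested
only below `2 ^ d`. For total weight `0` the second inequality fails there. -/
theorem pick_spec (r : ℕ) : prefixWeight lam ℓ h Q (pick lam ℓ h Q r) * 2 ^ coinLen lam d ≤
      r * prefixWeight lam ℓ h Q (2 ^ d) ∧
    (pick lam ℓ h Q r + 1 = 2 ^ d ∨ r * prefixWeight lam ℓ h Q (2 ^ d) <
      prefixWeight lam ℓ h Q (pick lam ℓ h Q r + 1) * 2 ^ coinLen lam d) := by
  have hlt := pick_lt (lam := lam) (ℓ := ℓ) (h := h) (Q := Q) r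
  obtain ⟨-, h₂, h₃⟩ := (Nat.findGreatest_eq_iff (m := pick lam ℓ h Q r)
    (P := fun x => prefixWeight lam ℓ h Q x * 2 ^ coinLen lam d ≤
    r * prefixWeight lam ℓ h Q (2 ^ d)) (k := 2 ^ d - 1)).1 rfl
  refine ⟨?_, ?_⟩
  · by_cases h0 : pick lam ℓ h Q r = 0
    · simp [h0, prefixWeight_zero]
    · exact h₂ h0
  · by_cases hp : pick lam ℓ h Q r + 1 = 2 ^ d
    · exact .inl hp
    · exact .inr (not_le.1 (h₃ (Nat.lt_succ_self _) (by omega)))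

theorem cast_num_den {r : ℚ} (hr : 0 ≤ r) : ((r.num.toNat : ℕ) : ℚ) = r * r.den := by
  have h₁ : ((r.num.toNat : ℕ) : ℤ) = r.num := Int.toNat_of_nonneg (Rat.num_nonneg.2 hr)
  have h₂ : ((r.num.toNat : ℕ) : ℚ) = (r.num : ℚ) := by exact_mod_cast h₁
  rw [h₂, Rat.mul_den_eq_num]

theorem cast_div_le_iff {A B n : ℕ} (hB : 0 < B) : n ≤ A / B ↔ (n * B : ℚ) ≤ A := by
  rw [Nat.le_div_iff_mul_le hB]
  exact_mod_cast Iff.rfl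

/-- The score is `⌊4 * (a + D - b) / D⌋` with `a`, `b` the distances from `f` and `D` the distance
of the hypotheses, cleared of denominators. Multiplied by `D`, the bounds become linear in the
distances and remain true for `D = 0`. -/
theorem score_bounds (hℓ : IsPreciseMetric lam ℓ) (f : Cube d → Y) (x : ℕ) :
    score ℓ f h x ≤ 8 ∧
    (score ℓ f h x : ℚ) * ℓ (h false (point d x)) (h true (point d x)) ≤
      4 * (ℓ (f (point d x)) (h false (point d x)) + ℓ (h false (point d x)) (h true (point d x))
        - ℓ (f (point d x)) (h true (point d x))) ∧
    4 * (ℓ (f (point d x)) (h false (point d x)) + ℓ (h false (point d x)) (h true (point d x))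
        - ℓ (f (point d x)) (h true (point d x))) ≤
      ((score ℓ f h x : ℚ) + 1) * ℓ (h false (point d x)) (h true (point d x)) := by
  unfold score
  have ta := hℓ.triangle (f (point d x)) (h false (point d x)) (h true (point d x))
  have tb := hℓ.triangle (f (point d x)) (h true (point d x)) (h false (point d x))
  rw [hℓ.symm (h true (point d x)) (h false (point d x))] at tb
  have a0 := hℓ.nonneg (f (point d x)) (h false (point d x))
  have b0 := hℓ.nonneg (f (point d x)) (h true (point d x))
  have D0 := hℓ.nonneg (h false (point d x)) (h true (point d x))
  generalize ℓ (f (point d x)) (h false (point d x)) = a at *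
  generalize ℓ (f (point d x)) (h true (point d x)) = b at *
  generalize ℓ (h false (point d x)) (h true (point d x)) = D at *
  have ha := cast_num_den a0
  have hb := cast_num_den b0
  have hD := cast_num_den D0
  have pa : (0 : ℚ) < a.den := by exact_mod_cast a.den_pos
  have pb : (0 : ℚ) < b.den := by exact_mod_cast b.den_pos
  have pD : (0 : ℚ) < D.den := by exact_mod_cast D.den_pos
  have hP : (0 : ℚ) < a.den * b.den * D.den := by positivity
  -- By the triangle inequality `b ≤ a + D`, the subtraction of naturals in `score` is not
  -- truncated.
  have hsub : b.num.toNat * (a.den * D.den) ≤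
      a.num.toNat * (b.den * D.den) + D.num.toNat * (a.den * b.den) := by
    have : ((b.num.toNat : ℕ) : ℚ) * (a.den * D.den) ≤
        (a.num.toNat : ℕ) * (b.den * D.den) + (D.num.toNat : ℕ) * (a.den * b.den) := by
      rw [ha, hb, hD]
      nlinarith [mul_le_mul_of_nonneg_right ta hP.le]
    exact_mod_cast this
  have hA : ((4 * (a.num.toNat * (b.den * D.den) + D.num.toNat * (a.den * b.den) -
      b.num.toNat * (a.den * D.den)) : ℕ) : ℚ) = 4 * (a + D - b) * (a.den * b.den * D.den) := by
    rw [Nat.cast_mul, Nat.cast_sub hsub]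
    push_cast
    rw [ha, hb, hD]
    ring
  have hB : ((D.num.toNat * (a.den * b.den) : ℕ) : ℚ) = D * (a.den * b.den * D.den) := by
    push_cast
    rw [hD]
    ring
  generalize 4 * (a.num.toNat * (b.den * D.den) + D.num.toNat * (a.den * b.den) -
      b.num.toNat * (a.den * D.den)) = A at *
  generalize D.num.toNat * (a.den * b.den) = B at *
  rcases D0.eq_or_lt with h0 | h0
  -- For `D = 0` division by zero gives score `0`, and the triangle inequalities force `a = b`.
  · have hB0 : B = 0 := by
      rw [← h0, zero_mul] at hB
      exact_mod_cast hB
    subst hB0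
    rw [← h0]
    simp only [Nat.div_zero, mul_zero]
    exact ⟨by norm_num, by linarith, by linarith⟩
  · have hBpos : 0 < B := by
      have : (0 : ℚ) < B := by rw [hB]; positivity
      exact_mod_cast this
    have l₁ : ((A / B : ℕ) : ℚ) * B ≤ A := (cast_div_le_iff hBpos).1 le_rfl
    have l₂ : (A : ℚ) < ((A / B : ℕ) + 1) * B := by
      have := Nat.lt_div_mul_add (a := A) hBpos
      have : A < (A / B + 1) * B := by rw [add_mul, one_mul]; exact this
      exact_mod_cast this
    rw [hA, hB] at l₁ l₂
    refine ⟨?_, ?_, ?_⟩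
    -- A score of `9` or more would give `9 * D ≤ 4 * (a + D - b) ≤ 8 * D`, since `a ≤ b + D`.
    · by_contra hc
      have hc' : (9 : ℚ) ≤ ((A / B : ℕ) : ℚ) := by exact_mod_cast (show 9 ≤ A / B by omega)
      have l₃ : ((A / B : ℕ) : ℚ) * D ≤ 4 * (a + D - b) := by
        rw [← mul_assoc] at l₁
        exact le_of_mul_le_mul_right l₁ hP
      nlinarith [mul_le_mul_of_nonneg_right hc' D0]
    · rw [← mul_assoc _ D] at l₁
      exact le_of_mul_le_mul_right l₁ hP
    · rw [← mul_assoc _ D] at l₂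
      exact (lt_of_mul_lt_mul_right l₂ hP.le).le

end Weights

end RefereedLearning

namespace RefereedLearning

/-! ### The verifier's program

Memory cells: `0` dimension, `2` logarithm of the inverse error, `3` number of samples, `4` sample
counter, `5` sum of scores, `6` total weight, `7` coins and search target, `8`, `9` search interval,
`10` argument of a prefix weight, `11` its value; the other cells are scratch space. -/

/-- Ask both provers for the prefix weight at the content of cell `j`; their answers are stored in
the cells `19` and `20`. -/
def ask (lam j : ℕ) : Prog :=
  .seq (.send false (.add (cell 0) (.const 1)) (cell j))
  (.seq (.receive false (.const 19) (.add (cell 0) (.const (4 * lam + 8))))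
  (.seq (.send true (.add (cell 0) (.const 1)) (cell j))
  (.receive true (.const 20) (.add (cell 0) (.const (4 * lam + 8))))))

/-- Halve the interval between the points where the provers agree (cell `13`) and disagree
(cell `14`). -/
def bisectStep (lam : ℕ) : Prog :=
  .seq (.assign (.const 18) (.div (.add (cell 13) (cell 14)) (.const 2)))
  (.seq (ask lam 18)
  (.ifLt (.add (.sub (cell 19) (cell 20)) (.sub (cell 20) (cell 19))) (.const 1)
    (.seq (.assign (.const 13) (cell 18)) (.assign (.const 15) (cell 19)))
    (.seq (.assign (.const 14) (cell 18))
      (.seq (.assign (.const 16) (cell 19)) (.assign (.const 17) (cell 20))))))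

/-- Compute the weight of the point encoded by cell `13` and choose between the answers in the
cells `11` and `12`. -/
def judge (lam : ℕ) : Prog :=
  .seq (.queryMass (.const 21) (cell 13))
  (.seq (.queryHyp false (.const 0) (cell 13))
  (.seq (.queryHyp true (.const 1) (cell 13))
  (.seq (.metric (.const 23) (.const 0) (.const 1))
  (.seq (.assign (.const 21) (.add (cell 15)
    (.div (.mul (.mul (cell 21) (cell 23)) (.shl (.const 1) (.const (2 * lam + 7))))
      (.mul (cell 22) (cell 24)))))
  (.ifLt (.add (.sub (cell 16) (cell 21)) (.sub (cell 21) (cell 16))) (.const 1)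
    .skip (.assign (.const 11) (cell 12)))))))

/-- Store the prefix weight at the content of cell `10` in cell `11`. -/
def getWeight (lam : ℕ) : Prog :=
  .seq (ask lam 10)
  (.seq (.assign (.const 11) (cell 19))
  (.seq (.assign (.const 12) (cell 20))
  (.seq (.assign (.const 16) (cell 19))
  (.seq (.assign (.const 17) (cell 20))
  (.seq (.assign (.const 13) (.const 0))
  (.seq (.assign (.const 14) (cell 10))
  (.seq (.assign (.const 15) (.const 0))
  (.seq (.whileLt (.add (cell 13) (.const 1)) (cell 14) (bisectStep lam))
  (judge lam)))))))))

/-- Halve the search interval for the sampled point. -/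
def searchStep (lam : ℕ) : Prog :=
  .seq (.assign (.const 10) (.div (.add (cell 8) (cell 9)) (.const 2)))
  (.seq (getWeight lam)
  (.ifLt (cell 7) (.mul (cell 11) (.shl (.const 1) (.add (cell 0) (.const (4 * lam + 15)))))
    (.assign (.const 9) (cell 10)) (.assign (.const 8) (cell 10))))

/-- Add the score of the point encoded by cell `8` to cell `5`, and `1` to cell `4`. -/
def scoreStep : Prog :=
  .seq (.queryHyp false (.const 0) (cell 8))
  (.seq (.queryHyp true (.const 1) (cell 8))
  (.seq (.queryTarget (.const 2) (cell 8))
  (.seq (.metric (.const 21) (.const 0) (.const 1))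
  (.seq (.metric (.const 23) (.const 2) (.const 0))
  (.seq (.metric (.const 25) (.const 2) (.const 1))
  (.seq (.assign (.const 5) (.add (cell 5)
    (.div (.mul (.const 4) (.sub
        (.add (.mul (cell 23) (.mul (cell 26) (cell 22))) (.mul (cell 21) (.mul (cell 24) (cell 26))))
        (.mul (cell 25) (.mul (cell 24) (cell 22)))))
      (.mul (cell 21) (.mul (cell 24) (cell 26))))))
  (.assign (.const 4) (.add (cell 4) (.const 1)))))))))

/-- Draw one sample and add its score. -/
def sampleStep (lam : ℕ) : Prog :=
  .seq (.toss (.const 7) (.add (cell 0) (.const (4 * lam + 15))))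
  (.seq (.assign (.const 7) (.mul (cell 7) (cell 6)))
  (.seq (.assign (.const 8) (.const 0))
  (.seq (.assign (.const 9) (.shl (.const 1) (cell 0)))
  (.seq (.whileLt (.add (cell 8) (.const 1)) (cell 9) (searchStep lam))
  scoreStep))))

/-- The verifier's program. -/
def verifier (lam : ℕ) : Prog :=
  .ifLt (cell 2) (.const 2) (.toss (.const 0) (.const 1))
  (.seq (.assign (.const 3) (.mul (.const 32) (cell 2)))
  (.seq (.assign (.const 10) (.shl (.const 1) (cell 0)))
  (.seq (getWeight lam)
  (.seq (.assign (.const 6) (cell 11))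
  (.seq (.whileLt (cell 4) (cell 3) (sampleStep lam))
  (.ifLt (cell 5) (.mul (.const 4) (cell 3))
    (.assign (.const 0) (.const 0)) (.assign (.const 0) (.const 1))))))))

/-- The honest prover answers with the prefix weight it is asked for. -/
def honestReply {Y : Type*} {d : ℕ} (lam : ℕ) (ℓ : Y → Y → ℚ) (h : Bool → Cube d → Y)
    (Q : Cube d → ℚ) : Strategy
  | [] => 0
  | e :: _ => prefixWeight lam ℓ h Q e.val

/-- The refereed learning protocol for `lam`-precise metrics. -/
def protocol {Y : Type*} (lam : ℕ) (ℓ : Y → Y → ℚ) : Protocol Y where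
  verifier := verifier lam
  prover := fun _ _ h Q => honestReply lam ℓ h Q

/-! ### Correctness of the program -/

/-- The data are precise and prover `b` is honest. -/
structure Honest {Y : Type*} {d : ℕ} (lam : ℕ) (E : Env Y d) (b : Bool) : Prop where
  metric : IsPreciseMetric lam E.ℓ
  dist : E.Q ∈ PreciseDist d lam
  reply : ∀ T : Transcript, E.reply b T = honestReply lam E.ℓ E.h E.Q (T.view b)

/-- A bound for the time of handling a number. -/
def opTime (lam d : ℕ) : ℕ := 8 * lam + 2 * d + 32

/-- At most `n` steps lead from `s` to `t`, without any coins or target queries. -/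
structure After {Y : Type*} (s t : State Y) (n : ℕ) : Prop where
  time : t.time ≤ s.time + n
  coins : t.coinsUsed = s.coinsUsed
  queries : t.targetQueries = s.targetQueries

variable {Y : Type*} {d lam : ℕ} {E : Env Y d} {b : Bool}

theorem one_le_opTime : 1 ≤ opTime lam d := by unfold opTime; omega

theorem cheap_of_lt {v n : ℕ} (hv : v < 2 ^ n) (hn : n ≤ opTime lam d) :
    numCost E.w v ≤ opTime lam d :=
  numCost_le_of_lt one_le_opTime (hv.trans_le (Nat.pow_le_pow_right (by norm_num) hn))

theorem cheap_of_le {v : ℕ} (hv : v ≤ opTime lam d) : numCost E.w v ≤ opTime lam d :=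
  numCost_le_of_lt one_le_opTime (hv.trans_lt Nat.lt_two_pow_self)

theorem cheap_of_lt_64 {v : ℕ} (hv : v < 64) : numCost E.w v ≤ opTime lam d :=
  cheap_of_lt (n := 6) (by simpa using hv) (by unfold opTime; omega)

/-! ### Prefix weights from two provers, one of them honest. -/

theorem bif_eq_of_eq {α : Type*} (b : Bool) (x : α) : (bif b then x else x) = x := by cases b <;> rfl

/-- When a prover is to reply, the newest message in its own view is the question, which is all that
`honestReply` reads. The last equation singles out the honest answer: `a₁` if `b` is `true`, `a₀`
otherwise. -/
theorem runs_ask (S : Honest lam E b) {j : ℕ} (hj : j < 19) {s : State Y} (h0 : s.mem 0 = d)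
    (hi : s.mem j ≤ 2 ^ d) {Post : State Y → Prop}
    (h : ∀ a₀ a₁ t, After s t (30 * opTime lam d) →
      t.mem = Function.update (Function.update s.mem 19 a₀) 20 a₁ →
      a₀ < 2 ^ answerLen lam d → a₁ < 2 ^ answerLen lam d →
      (bif b then a₁ else a₀) = prefixWeight lam E.ℓ E.h E.Q (s.mem j) → Post t) :
    Runs E (ask lam j) s Post := by
  have hA : d + (4 * lam + 8) = answerLen lam d := by unfold answerLen; omega
  have hop : opTime lam d = 8 * lam + 2 * d + 32 := rfl
  -- Arguments up to and including `2 ^ d` are asked for, hence `d + 1` bits.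
  have hmod : s.mem j % 2 ^ (d + 1) = s.mem j :=
    Nat.mod_eq_of_lt (hi.trans_lt (Nat.pow_lt_pow_right (by norm_num) (Nat.lt_succ_self d)))
  have hF : prefixWeight lam E.ℓ E.h E.Q (s.mem j) % 2 ^ answerLen lam d =
      prefixWeight lam E.ℓ E.h E.Q (s.mem j) :=
    Nat.mod_eq_of_lt (prefixWeight_lt S.metric S.dist hi)
  have c0 : ∀ v < 64, numCost E.w v ≤ opTime lam d := fun v hv => cheap_of_lt_64 hv
  have c1 : numCost E.w d ≤ opTime lam d := cheap_of_le (by omega)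
  have c2 : numCost E.w (d + 1) ≤ opTime lam d := cheap_of_le (by omega)
  have c3 : numCost E.w (4 * lam + 8) ≤ opTime lam d := cheap_of_le (by omega)
  have c4 : numCost E.w (answerLen lam d) ≤ opTime lam d := cheap_of_le (by omega)
  have c5 : numCost E.w (s.mem j) ≤ opTime lam d :=
    cheap_of_lt (n := d + 1)
      (hi.trans_lt (Nat.pow_lt_pow_right (by norm_num) (Nat.lt_succ_self d))) (by omega)
  have hj19 : j ≠ 19 := by omega
  unfold ask
  refine Runs.seq (Runs.send (H := opTime lam d) one_le_opTime ?_ ?_ fun τ₁ hτ₁ => ?_)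
  · simp [Expr.Cheap, Expr.eval, h0, c0, c1, c2]
  · exact ⟨c0 j (by omega), c5⟩
  refine Runs.seq (Runs.receive (H := opTime lam d) (c0 _ (by norm_num)) ?_ fun τ₂ hτ₂ => ?_)
  · simp [Expr.Cheap, Expr.eval, h0, hA, c0, c1, c3, c4]
  refine Runs.seq (Runs.send (H := opTime lam d) one_le_opTime ?_ ?_ fun τ₃ hτ₃ => ?_)
  · simp [Expr.Cheap, Expr.eval, h0, c0, c1, c2]
  · simp [hj19, c5, c0 j (by omega)]
  refine Runs.receive (H := opTime lam d) (c0 _ (by norm_num)) ?_ fun τ₄ hτ₄ => ?_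
  · simp [Expr.Cheap, Expr.eval, h0, hA, c0, c1, c3, c4]
  simp only [Expr.eval, cell_eval, Expr.nodes, cell_nodes, Function.update_of_ne, ne_eq, hj19,
    not_false_eq_true, h0, hA, OfNat.zero_ne_ofNat] at hτ₁ hτ₂ hτ₃ hτ₄ ⊢
  refine h _ _ _ ⟨?_, rfl, rfl⟩ rfl (Nat.mod_lt _ (by positivity)) (Nat.mod_lt _ (by positivity)) ?_
  · dsimp only
    omega
  · cases b
    · simp [S.reply, Transcript.view, honestReply, hmod, hF]
    · simp [S.reply, Transcript.view, honestReply, hmod, hF]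

/-- The invariant of the loop that narrows down the disagreement of the provers, `s₀` being the
configuration before the loop. -/
structure BisectInv (lam : ℕ) (E : Env Y d) (b : Bool) (s₀ : State Y) (k : ℕ) (s : State Y) :
    Prop where
  frame : ∀ i < 13, s.mem i = s₀.mem i
  lt : s.mem 13 < s.mem 14
  le : s.mem 14 ≤ 2 ^ d
  width : s.mem 14 ≤ s.mem 13 + 2 ^ k
  low : s.mem 15 = prefixWeight lam E.ℓ E.h E.Q (s.mem 13)
  high : (bif b then s.mem 17 else s.mem 16) = prefixWeight lam E.ℓ E.h E.Q (s.mem 14)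
  first_lt : s.mem 16 < 2 ^ answerLen lam d
  second_lt : s.mem 17 < 2 ^ answerLen lam d
  diff : s₀.mem 11 ≠ s₀.mem 12 → s.mem 16 ≠ s.mem 17
  coins : s.coinsUsed = s₀.coinsUsed
  queries : s.targetQueries = s₀.targetQueries
  time : s.time + k * (80 * opTime lam d) ≤ s₀.time + d * (80 * opTime lam d)

theorem two_pow_lt_two_pow_succ (d : ℕ) : 2 ^ d < 2 ^ (d + 1) :=
  Nat.pow_lt_pow_right (by norm_num) (Nat.lt_succ_self d)

/-- If the answers at the midpoint agree, they are correct, one prover being honest, and the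
midpoint becomes the lower end. Otherwise it becomes the upper end, with the two conflicting answers
recorded. -/
theorem runs_bisectStep (S : Honest lam E b) {s₀ s : State Y} (h0 : s₀.mem 0 = d) {k : ℕ}
    (hs : BisectInv lam E b s₀ (k + 1) s) (hlt : s.mem 13 + 1 < s.mem 14) {τ : ℕ}
    (hτ : τ ≤ s.time + 7 * opTime lam d) :
    Runs E (bisectStep lam) { s with time := τ } (BisectInv lam E b s₀ k) := by
  obtain ⟨frame, lt, le, width, low, high, f16, f17, diff, coins, queries, time⟩ := hs
  have hop : opTime lam d = 8 * lam + 2 * d + 32 := rfl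
  have hans : answerLen lam d = 4 * lam + d + 8 := rfl
  have c0 : ∀ v < 64, numCost E.w v ≤ opTime lam d := fun v hv => cheap_of_lt_64 hv
  have hd := two_pow_lt_two_pow_succ d
  have c1 : ∀ v ≤ 2 ^ (d + 1), numCost E.w v ≤ opTime lam d := fun v hv =>
    cheap_of_lt (hv.trans_lt (two_pow_lt_two_pow_succ (d + 1))) (by omega)
  have c2 : ∀ v < 2 ^ (answerLen lam d + 1), numCost E.w v ≤ opTime lam d := fun v hv =>
    cheap_of_lt hv (by omega)
  have hans' := two_pow_lt_two_pow_succ (answerLen lam d)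
  have hpow : 2 ^ (k + 1) = 2 * 2 ^ k := by ring
  have hpow' : 2 ^ (answerLen lam d + 1) = 2 * 2 ^ answerLen lam d := by ring
  have hpow'' : 2 ^ (d + 1) = 2 * 2 ^ d := by ring
  unfold bisectStep
  refine Runs.seq (Runs.assign (H := opTime lam d) (c0 _ (by norm_num)) ?_ fun τ₁ hτ₁ => ?_)
  · simp only [Expr.Cheap, Expr.eval, cell_cheap, cell_eval]
    refine ⟨⟨⟨c0 _ (by norm_num), c1 _ (by omega)⟩, ⟨c0 _ (by norm_num), c1 _ (by omega)⟩,
      c1 _ (by omega)⟩, c0 _ (by norm_num), c1 _ (by omega)⟩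
  simp only [Expr.nodes, cell_nodes, Expr.eval, cell_eval] at hτ₁ ⊢
  refine Runs.seq (runs_ask S (j := 18) (by norm_num) ?_ ?_ fun a₀ a₁ t ht hmem ha₀ ha₁ ha => ?_)
  · simp [frame, h0]
  · simp only [Function.update_self]; omega
  obtain ⟨mem, reg, tr, cu, τ₂, tq⟩ := t
  dsimp only at hmem
  subst hmem
  simp only [Function.update_self] at ha
  obtain ⟨ht₁, ht₂, ht₃⟩ := ht
  dsimp only at ht₁ ht₂ ht₃
  -- With truncated subtraction, `(u - v) + (v - u) < 1` says that `u = v`.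
  refine Runs.ifLt (H := opTime lam d) one_le_opTime ?_ ?_ (fun hc τ₃ hτ₃ => ?_)
    (fun hc τ₃ hτ₃ => ?_)
  · simp [Expr.Cheap, Expr.eval, c0]
    refine ⟨⟨c2 _ (by omega), c2 _ (by omega), c2 _ (by omega)⟩,
      ⟨c2 _ (by omega), c2 _ (by omega), c2 _ (by omega)⟩, c2 _ (by omega)⟩
  · exact c0 _ (by norm_num)
  · simp [Expr.eval, Expr.nodes] at hc hτ₃
    refine Runs.seq (Runs.assign (H := opTime lam d) (c0 _ (by norm_num)) ?_ fun τ₄ hτ₄ => ?_)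
    · simp [c0]
      exact c1 _ (by omega)
    refine Runs.assign (H := opTime lam d) (c0 _ (by norm_num)) ?_ fun τ₅ hτ₅ => ?_
    · simp [c0]
      exact c2 _ (by omega)
    have heq : a₀ = a₁ := by omega
    subst heq
    rw [bif_eq_of_eq] at ha
    simp at hτ₄ hτ₅
    constructor
    case frame =>
      intro i hi
      rw [← frame i hi]
      simp [show i ≠ 13 by omega, show i ≠ 15 by omega,
        show i ≠ 18 by omega, show i ≠ 19 by omega, show i ≠ 20 by omega]
    all_goals simp
    · omega
    · exact le
    · omega
    · exact ha
    · exact high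
    · exact f16
    · exact f17
    · exact diff
    · omega
    · omega
    · have : (k + 1) * (80 * opTime lam d) = k * (80 * opTime lam d) + 80 * opTime lam d := by ring
      omega
  · simp [Expr.eval, Expr.nodes] at hc hτ₃
    refine Runs.seq (Runs.assign (H := opTime lam d) (c0 _ (by norm_num)) ?_ fun τ₄ hτ₄ => ?_)
    · simp [c0]
      exact c1 _ (by omega)
    refine Runs.seq (Runs.assign (H := opTime lam d) (c0 _ (by norm_num)) ?_ fun τ₅ hτ₅ => ?_)
    · simp [c0]
      exact c2 _ (by omega)
    refine Runs.assign (H := opTime lam d) (c0 _ (by norm_num)) ?_ fun τ₆ hτ₆ => ?_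
    · simp [c0]
      exact c2 _ (by omega)
    simp at hτ₄ hτ₅ hτ₆
    constructor
    case frame =>
      intro i hi
      rw [← frame i hi]
      simp [show i ≠ 14 by omega, show i ≠ 16 by omega,
        show i ≠ 17 by omega, show i ≠ 18 by omega, show i ≠ 19 by omega, show i ≠ 20 by omega]
    all_goals simp
    · omega
    · omega
    · omega
    · exact low
    · exact ha
    · exact ha₀
    · exact ha₁
    · omega
    · omega
    · omega
    · have : (k + 1) * (80 * opTime lam d) = k * (80 * opTime lam d) + 80 * opTime lam d := by ring
      omega

theorem cheap_precise {r : ℚ} (hr : r ∈ PreciseRat lam) (w : ℕ) :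
    numCost w r.num.toNat ≤ opTime lam d ∧ numCost w r.den ≤ opTime lam d := by
  have h := PreciseRat.num_den_le hr
  have hl := two_pow_lt_two_pow_succ lam
  have hop : lam + 1 ≤ opTime lam d := by unfold opTime; omega
  constructor
  · exact numCost_le_of_lt one_le_opTime
      ((h.1.trans_lt hl).trans_le (Nat.pow_le_pow_right (by norm_num) hop))
  · exact numCost_le_of_lt one_le_opTime
      ((h.2.trans_lt hl).trans_le (Nat.pow_le_pow_right (by norm_num) hop))

/-- A correct prefix weight at `x` plus the weight of `x`, computed from queries to the mass
function and the hypotheses, is the correct one at `x + 1`. Prover `false` is believed exactly if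
its answer there passes this test. -/
theorem runs_judge (S : Honest lam E b) {s : State Y} (hx : s.mem 13 < 2 ^ d)
    (h15 : s.mem 15 = prefixWeight lam E.ℓ E.h E.Q (s.mem 13))
    (h12 : s.mem 12 < 2 ^ answerLen lam d) (h16 : s.mem 16 < 2 ^ answerLen lam d)
    {Post : State Y → Prop}
    (h : ∀ t, After s t (60 * opTime lam d) → (∀ i < 11, t.mem i = s.mem i) →
      t.mem 11 = (if s.mem 16 = prefixWeight lam E.ℓ E.h E.Q (s.mem 13 + 1) then s.mem 11
        else s.mem 12) → Post t) :
    Runs E (judge lam) s Post := by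
  have hop : opTime lam d = 8 * lam + 2 * d + 32 := rfl
  have hans : answerLen lam d = 4 * lam + d + 8 := rfl
  have c0 : ∀ v < 64, numCost E.w v ≤ opTime lam d := fun v hv => cheap_of_lt_64 hv
  have cx : numCost E.w (s.mem 13) ≤ opTime lam d := cheap_of_lt hx (by omega)
  have c2 : ∀ v < 2 ^ (answerLen lam d + 1), numCost E.w v ≤ opTime lam d := fun v hv =>
    cheap_of_lt hv (by omega)
  have hans' : 2 ^ (answerLen lam d + 1) = 2 * 2 ^ answerLen lam d := by ring
  have hF : prefixWeight lam E.ℓ E.h E.Q (s.mem 13 + 1) < 2 ^ answerLen lam d :=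
    prefixWeight_lt S.metric S.dist (Nat.succ_le_of_lt hx)
  have hF' := prefixWeight_lt (h := E.h) S.metric S.dist hx.le
  have hsucc := prefixWeight_succ (lam := lam) (ℓ := E.ℓ) (h := E.h) (Q := E.Q) (s.mem 13)
  have hW := weight_numerator_le (h := E.h) S.metric S.dist (s.mem 13)
  obtain ⟨q, hqe⟩ : ∃ q, E.Q (point d (s.mem 13)) = q := ⟨_, rfl⟩
  obtain ⟨D, hDe⟩ : ∃ D, E.ℓ (E.h false (point d (s.mem 13))) (E.h true (point d (s.mem 13))) = D :=
    ⟨_, rfl⟩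
  have hq : q ∈ PreciseRat lam := hqe ▸ S.dist.2.2 _
  have hD : D ∈ PreciseRat lam := hDe ▸ S.metric.precise _ _
  rw [hqe, hDe] at hW
  have hweight : q.num.toNat * D.num.toNat * 2 ^ (2 * lam + 7) / (q.den * D.den) =
      weight lam E.ℓ E.h E.Q (s.mem 13) := by rw [weight, hqe, hDe]
  have hq' := PreciseRat.num_den_le hq
  have hD' := PreciseRat.num_den_le hD
  have ⟨cq, cq'⟩ := cheap_precise (d := d) hq E.w
  have ⟨cD, cD'⟩ := cheap_precise (d := d) hD E.w
  have hmul : q.num.toNat * D.num.toNat < 2 ^ (2 * lam + 1) := by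
    calc _ ≤ 2 ^ lam * 2 ^ lam := Nat.mul_le_mul hq'.1 hD'.1
      _ = 2 ^ (2 * lam) := by rw [← pow_add]; congr 1; ring
      _ < _ := two_pow_lt_two_pow_succ _
  have hmul' : q.den * D.den < 2 ^ (2 * lam + 1) := by
    calc _ ≤ 2 ^ lam * 2 ^ lam := Nat.mul_le_mul hq'.2 hD'.2
      _ = 2 ^ (2 * lam) := by rw [← pow_add]; congr 1; ring
      _ < _ := two_pow_lt_two_pow_succ _
  have c3 : numCost E.w (2 * lam + 7) ≤ opTime lam d := cheap_of_le (by omega)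
  have c4 : numCost E.w (2 ^ (2 * lam + 7)) ≤ opTime lam d :=
    cheap_of_lt (two_pow_lt_two_pow_succ _) (by omega)
  have cm := cheap_of_lt (lam := lam) (d := d) (E := E) hmul (by omega)
  have cm' := cheap_of_lt (lam := lam) (d := d) (E := E) hmul' (by omega)
  have cM := cheap_of_lt (lam := lam) (d := d) (E := E)
    (hW.trans_lt (two_pow_lt_two_pow_succ _)) (by omega)
  unfold judge
  refine Runs.seq (Runs.queryMass (H := opTime lam d) (r := q) (c0 _ (by norm_num)) ?_ ?_ cq cq'
    fun τ₁ hτ₁ => ?_)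
  · simp [c0, cx]
  · simpa using hqe
  refine Runs.seq (Runs.queryHyp (H := opTime lam d) (c0 _ (by norm_num)) ?_ fun τ₂ hτ₂ => ?_)
  · simp [c0, cx, storeRat]
  refine Runs.seq (Runs.queryHyp (H := opTime lam d) (c0 _ (by norm_num)) ?_ fun τ₃ hτ₃ => ?_)
  · simp [c0, cx, storeRat]
  refine Runs.seq (Runs.metric (H := opTime lam d) (c0 _ (by norm_num)) (c0 _ (by norm_num))
    (c0 _ (by norm_num)) (by simpa [metricVal, storeRat] using hDe) cD cD' fun τ₄ hτ₄ => ?_)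
  refine Runs.seq (Runs.assign (H := opTime lam d) (c0 _ (by norm_num)) ?_ fun τ₅ hτ₅ => ?_)
  · simp [Expr.Cheap, Expr.eval, storeRat, c0, cq, cq', cD, cD', c3, c4, cm, cm', cM, h15, hweight]
    exact ⟨c2 _ (by omega), c2 _ (by omega), c2 _ (by omega)⟩
  simp [Expr.nodes, Expr.eval, storeRat, h15, hweight] at hτ₁ hτ₂ hτ₃ hτ₄ hτ₅ ⊢
  refine Runs.ifLt (H := opTime lam d) one_le_opTime ?_ ?_ (fun hc τ₆ hτ₆ => ?_)
    (fun hc τ₆ hτ₆ => ?_)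
  · simp [Expr.Cheap, Expr.eval, c0]
    exact ⟨⟨c2 _ (by omega), c2 _ (by omega), c2 _ (by omega)⟩,
      ⟨c2 _ (by omega), c2 _ (by omega), c2 _ (by omega)⟩, c2 _ (by omega)⟩
  · exact c0 _ (by norm_num)
  · simp [Expr.eval, Expr.nodes] at hc hτ₆
    refine Runs.skip (h _ ⟨?_, rfl, rfl⟩ (fun i hi => ?_) ?_)
    · dsimp only
      omega
    · simp [show i ≠ 21 by omega, show i ≠ 22 by omega, show i ≠ 23 by omega,
        show i ≠ 24 by omega]
    · simp
      omega
  · simp [Expr.eval, Expr.nodes] at hc hτ₆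
    refine Runs.assign (H := opTime lam d) (c0 _ (by norm_num)) ?_ fun τ₇ hτ₇ => ?_
    · simp [c0]
      exact c2 _ (by omega)
    simp at hτ₇
    refine h _ ⟨?_, rfl, rfl⟩ (fun i hi => ?_) ?_
    · dsimp only
      omega
    · simp [show i ≠ 11 by omega, show i ≠ 21 by omega, show i ≠ 22 by omega,
        show i ≠ 23 by omega, show i ≠ 24 by omega]
    · simp
      omega

/-- The bisection also runs if the first two answers agree. They are then both correct, so the
verdict of `judge` is irrelevant; this is why `BisectInv.diff` is conditional. -/
theorem runs_getWeight (S : Honest lam E b) {s : State Y} (h0 : s.mem 0 = d) (h1 : 1 ≤ s.mem 10)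
    (h2 : s.mem 10 ≤ 2 ^ d) {Post : State Y → Prop}
    (h : ∀ t, After s t (160 * (d + 1) * opTime lam d) → (∀ i < 11, t.mem i = s.mem i) →
      t.mem 11 = prefixWeight lam E.ℓ E.h E.Q (s.mem 10) → Post t) :
    Runs E (getWeight lam) s Post := by
  have hop : opTime lam d = 8 * lam + 2 * d + 32 := rfl
  have hans : answerLen lam d = 4 * lam + d + 8 := rfl
  have c0 : ∀ v < 64, numCost E.w v ≤ opTime lam d := fun v hv => cheap_of_lt_64 hv
  have hd := two_pow_lt_two_pow_succ d
  have c1 : ∀ v ≤ 2 ^ (d + 1), numCost E.w v ≤ opTime lam d := fun v hv =>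
    cheap_of_lt (hv.trans_lt (two_pow_lt_two_pow_succ (d + 1))) (by omega)
  have c2 : ∀ v < 2 ^ answerLen lam d, numCost E.w v ≤ opTime lam d := fun v hv =>
    cheap_of_lt hv (by omega)
  unfold getWeight
  refine Runs.seq (runs_ask S (j := 10) (by norm_num) h0 h2 fun a₀ a₁ t ht hmem ha₀ ha₁ ha => ?_)
  obtain ⟨mem, reg, tr, cu, τ, tq⟩ := t
  dsimp only at hmem
  subst hmem
  obtain ⟨ht₁, ht₂, ht₃⟩ := ht
  dsimp only at ht₁ ht₂ ht₃
  refine Runs.seq (Runs.assign (H := opTime lam d) (c0 _ (by norm_num)) ?_ fun τ₁ hτ₁ => ?_)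
  · simp [c0, c2, ha₀]
  refine Runs.seq (Runs.assign (H := opTime lam d) (c0 _ (by norm_num)) ?_ fun τ₂ hτ₂ => ?_)
  · simp [c0, c2, ha₁]
  refine Runs.seq (Runs.assign (H := opTime lam d) (c0 _ (by norm_num)) ?_ fun τ₃ hτ₃ => ?_)
  · simp [c0, c2, ha₀]
  refine Runs.seq (Runs.assign (H := opTime lam d) (c0 _ (by norm_num)) ?_ fun τ₄ hτ₄ => ?_)
  · simp [c0, c2, ha₁]
  refine Runs.seq (Runs.assign (H := opTime lam d) (c0 _ (by norm_num)) ?_ fun τ₅ hτ₅ => ?_)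
  · exact c0 _ (by norm_num)
  refine Runs.seq (Runs.assign (H := opTime lam d) (c0 _ (by norm_num)) ?_ fun τ₆ hτ₆ => ?_)
  · simp [c0]
    exact c1 _ (by omega)
  refine Runs.seq (Runs.assign (H := opTime lam d) (c0 _ (by norm_num)) ?_ fun τ₇ hτ₇ => ?_)
  · exact c0 _ (by norm_num)
  simp [Expr.nodes, Expr.eval] at hτ₁ hτ₂ hτ₃ hτ₄ hτ₅ hτ₆ hτ₇ ⊢
  generalize hs₀ : State.mk (Y := Y) _ _ _ _ _ _ = s₀
  have frame : ∀ i < 11, s₀.mem i = s.mem i := by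
    intro i hi
    subst hs₀
    simp [show i ≠ 11 by omega, show i ≠ 12 by omega, show i ≠ 13 by omega, show i ≠ 14 by omega,
      show i ≠ 15 by omega, show i ≠ 16 by omega, show i ≠ 17 by omega, show i ≠ 19 by omega,
      show i ≠ 20 by omega]
  have hafter : After s s₀ (58 * opTime lam d) := by
    subst hs₀
    exact ⟨by dsimp only; omega, ht₂, ht₃⟩
  have h11 : s₀.mem 11 = a₀ := by subst hs₀; simp
  have h12 : s₀.mem 12 = a₁ := by subst hs₀; simp
  -- The lower end starts at `0`, where the prefix weight is `0` without asking anybody, and the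
  -- interval has length at most `2 ^ d`.
  have hinv : BisectInv lam E b s₀ d s₀ := by
    constructor <;> subst hs₀ <;> simp
    · omega
    · exact h2
    · exact h2
    · exact prefixWeight_zero.symm
    · exact ha
    · exact ha₀
    · exact ha₁
  refine Runs.seq (Runs.whileLt (H := opTime lam d) (BisectInv lam E b s₀) one_le_opTime ?_ ?_ ?_ ?_
    d hinv)
  · intro k u hu
    have := hu.lt
    have := hu.le
    simp [Expr.Cheap, Expr.eval, c0]
    exact ⟨⟨c1 _ (by omega), c1 _ (by omega)⟩, c1 _ (by omega)⟩
  · intro u hu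
    have := hu.width
    simp [Expr.eval]
    omega
  · intro k u hu hlt τ' hτ'
    exact runs_bisectStep S ((frame 0 (by norm_num)).trans h0) hu hlt hτ'
  · intro k u hu hlt τ' hτ'
    simp [Expr.eval, Expr.nodes] at hlt hτ'
    have hlt' := hu.lt
    have hle := hu.le
    -- A nonempty interval that cannot be halved any more consists of neighbours.
    have h14 : u.mem 14 = u.mem 13 + 1 := by omega
    have htime := hu.time
    refine runs_judge S (s := { u with time := τ' }) ?_ hu.low ?_ hu.first_lt
      fun t ht hmem hval => h t ?_ ?_ ?_
    · dsimp only
      omega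
    · dsimp only
      rw [hu.frame 12 (by norm_num), h12]
      exact ha₁
    · refine ⟨?_, ?_, ?_⟩
      · have h₁ := ht.time
        have h₂ := hafter.time
        dsimp only at h₁
        have h₃ : 160 * (d + 1) * opTime lam d =
          d * (80 * opTime lam d) + (80 * d + 160) * opTime lam d := by ring
        have h₄ : 160 * opTime lam d ≤ (80 * d + 160) * opTime lam d :=
          Nat.mul_le_mul_right _ (by omega)
        omega
      · exact ht.coins.trans (hu.coins.trans hafter.coins)
      · exact ht.queries.trans (hu.queries.trans hafter.queries)
    · intro i hi
      exact (hmem i hi).trans ((hu.frame i (by omega)).trans (frame i hi))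
    · rw [hval]
      dsimp only
      have hd := hu.diff
      have hh := hu.high
      rw [hu.frame 11 (by norm_num), hu.frame 12 (by norm_num), h11, h12, ← h14]
      rw [h11, h12] at hd
      -- If prover `false` is honest, it passes the test. If prover `true` is honest and the first
      -- answers differed, the recorded answers at the upper end differ too, so prover `false` fails
      -- it.
      cases b
      · simp at hh ha
        simp [hh, ha]
      · simp at hh ha
        rw [← hh, ← ha]
        by_cases hc : a₀ = a₁
        · simp [hc]
        · simp [hd hc]

/-! ### Drawing and scoring the samples. -/

/-- The invariant of the search for the sampled point, `s₀` being the configuration before the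
loop. -/
structure SearchInv (lam : ℕ) (E : Env Y d) (s₀ : State Y) (k : ℕ) (s : State Y) : Prop where
  frame : ∀ i < 8, s.mem i = s₀.mem i
  lt : s.mem 8 < s.mem 9
  le : s.mem 9 ≤ 2 ^ d
  width : s.mem 9 ≤ s.mem 8 + 2 ^ k
  low : prefixWeight lam E.ℓ E.h E.Q (s.mem 8) * 2 ^ coinLen lam d ≤ s₀.mem 7
  high : s.mem 9 = 2 ^ d ∨ s₀.mem 7 < prefixWeight lam E.ℓ E.h E.Q (s.mem 9) * 2 ^ coinLen lam d
  coins : s.coinsUsed = s₀.coinsUsed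
  queries : s.targetQueries = s₀.targetQueries
  time : s.time + k * (200 * (d + 1) * opTime lam d) ≤
    s₀.time + d * (200 * (d + 1) * opTime lam d)

/-- Cell `7` holds the product of the coins with the total weight. Comparing it with a prefix weight
times `2 ^ coinLen lam d` inverts the cumulative distribution without a division. -/
theorem runs_searchStep (S : Honest lam E b) {s₀ s : State Y} (h0 : s₀.mem 0 = d)
    (h7 : s₀.mem 7 < 2 ^ (answerLen lam d + coinLen lam d)) {k : ℕ}
    (hs : SearchInv lam E s₀ (k + 1) s) (hlt : s.mem 8 + 1 < s.mem 9) {τ : ℕ}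
    (hτ : τ ≤ s.time + 7 * opTime lam d) :
    Runs E (searchStep lam) { s with time := τ } (SearchInv lam E s₀ k) := by
  obtain ⟨frame, lt, le, width, low, high, coins, queries, time⟩ := hs
  have hop : opTime lam d = 8 * lam + 2 * d + 32 := rfl
  have hans : answerLen lam d = 4 * lam + d + 8 := rfl
  have hcoin : coinLen lam d = 4 * lam + d + 15 := rfl
  have hcoin' : d + (4 * lam + 15) = coinLen lam d := by omega
  have c0 : ∀ v < 64, numCost E.w v ≤ opTime lam d := fun v hv => cheap_of_lt_64 hv
  have hd := two_pow_lt_two_pow_succ d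
  have c1 : ∀ v ≤ 2 ^ (d + 1), numCost E.w v ≤ opTime lam d := fun v hv =>
    cheap_of_lt (hv.trans_lt (two_pow_lt_two_pow_succ (d + 1))) (by omega)
  have c2 : ∀ v < 2 ^ (answerLen lam d + coinLen lam d), numCost E.w v ≤ opTime lam d :=
    fun v hv => cheap_of_lt hv (by omega)
  have c3 : ∀ v ≤ opTime lam d, numCost E.w v ≤ opTime lam d := fun v hv => cheap_of_le hv
  have c4 : numCost E.w (2 ^ coinLen lam d) ≤ opTime lam d :=
    cheap_of_lt (two_pow_lt_two_pow_succ _) (by omega)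
  have hpow : 2 ^ (k + 1) = 2 * 2 ^ k := by ring
  have hpow'' : 2 ^ (d + 1) = 2 * 2 ^ d := by ring
  have htime : (k + 1) * (200 * (d + 1) * opTime lam d) =
    k * (200 * (d + 1) * opTime lam d) + 200 * (d + 1) * opTime lam d := by ring
  have htime' : 200 * (d + 1) * opTime lam d =
    160 * (d + 1) * opTime lam d + (40 * d + 40) * opTime lam d := by ring
  have htime'' : 40 * opTime lam d ≤ (40 * d + 40) * opTime lam d :=
    Nat.mul_le_mul_right _ (by omega)
  unfold searchStep
  refine Runs.seq (Runs.assign (H := opTime lam d) (c0 _ (by norm_num)) ?_ fun τ₁ hτ₁ => ?_)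
  · simp only [Expr.Cheap, Expr.eval, cell_cheap, cell_eval]
    refine ⟨⟨⟨c0 _ (by norm_num), c1 _ (by omega)⟩, ⟨c0 _ (by norm_num), c1 _ (by omega)⟩,
      c1 _ (by omega)⟩, c0 _ (by norm_num), c1 _ (by omega)⟩
  simp only [Expr.nodes, cell_nodes, Expr.eval, cell_eval] at hτ₁ ⊢
  refine Runs.seq (runs_getWeight S ?_ ?_ ?_ fun t ht hmem hval => ?_)
  · simp [frame, h0]
  · simp only [Function.update_self]; omega
  · simp only [Function.update_self]; omega
  simp only [Function.update_self] at hval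
  have hF : prefixWeight lam E.ℓ E.h E.Q ((s.mem 8 + s.mem 9) / 2) < 2 ^ answerLen lam d :=
    prefixWeight_lt S.metric S.dist (by omega)
  have hmul : t.mem 11 * 2 ^ coinLen lam d < 2 ^ (answerLen lam d + coinLen lam d) := by
    rw [hval, pow_add]
    exact Nat.mul_lt_mul_of_pos_right hF (by positivity)
  have hF' : t.mem 11 < 2 ^ (answerLen lam d + coinLen lam d) := by
    rw [hval]
    exact hF.trans_le (Nat.pow_le_pow_right (by norm_num) (by omega))
  have t10 : t.mem 10 = (s.mem 8 + s.mem 9) / 2 := by simp [hmem 10 (by norm_num)]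
  have t9 : t.mem 9 = s.mem 9 := by simp [hmem 9 (by norm_num)]
  have t8 : t.mem 8 = s.mem 8 := by simp [hmem 8 (by norm_num)]
  have tframe : ∀ i < 8, t.mem i = s₀.mem i := by
    intro i hi
    rw [hmem i (by omega), ← frame i hi]
    simp [show i ≠ 10 by omega]
  have t0 : t.mem 0 = d := by rw [tframe 0 (by norm_num), h0]
  have t7 : t.mem 7 = s₀.mem 7 := tframe 7 (by norm_num)
  obtain ⟨ht₁, ht₂, ht₃⟩ := ht
  dsimp only at ht₁ ht₂ ht₃
  refine Runs.ifLt (H := opTime lam d) one_le_opTime ?_ ?_ (fun hc τ₃ hτ₃ => ?_)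
    (fun hc τ₃ hτ₃ => ?_)
  · simp only [cell_cheap, t7]
    exact ⟨c0 _ (by norm_num), c2 _ h7⟩
  · simp [Expr.Cheap, Expr.eval, c0, t0, hcoin', c4]
    exact ⟨c2 _ hF', ⟨c3 _ (by omega), c3 _ (by omega), c3 _ (by omega)⟩, c2 _ hmul⟩
  · simp [Expr.eval, Expr.nodes, t0, hcoin'] at hc hτ₃
    refine Runs.assign (H := opTime lam d) (c0 _ (by norm_num)) ?_ fun τ₄ hτ₄ => ?_
    · simp [c0]
      exact c1 _ (by omega)
    simp at hτ₄
    constructor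
    case frame =>
      intro i hi
      rw [← tframe i hi]
      simp [show i ≠ 9 by omega]
    all_goals simp
    · omega
    · omega
    · omega
    · rw [t8]; exact low
    · rw [t10, ← hval, ← t7]; exact .inr hc
    · omega
    · omega
    · omega
  · simp [Expr.eval, Expr.nodes, t0, hcoin'] at hc hτ₃
    refine Runs.assign (H := opTime lam d) (c0 _ (by norm_num)) ?_ fun τ₄ hτ₄ => ?_
    · simp [c0]
      exact c1 _ (by omega)
    simp at hτ₄
    constructor
    case frame =>
      intro i hi
      rw [← tframe i hi]
      simp [show i ≠ 8 by omega]
    all_goals simp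
    · omega
    · omega
    · omega
    · rw [t10, ← hval, ← t7]; exact hc
    · rw [t9]; exact high
    · omega
    · omega
    · omega

/-- This is the only place where the program queries `f`, once per sample. Numerators and
denominators are multiplied at most three at a time, so all intermediate numbers have `O(lam)` bits.
-/
theorem runs_scoreStep (S : Honest lam E b) {s : State Y} (hx : s.mem 8 < 2 ^ d)
    (h4 : numCost E.w (s.mem 4) ≤ opTime lam d) (h4' : numCost E.w (s.mem 4 + 1) ≤ opTime lam d)
    (h5 : numCost E.w (s.mem 5) ≤ opTime lam d)
    (h5' : numCost E.w (s.mem 5 + score E.ℓ E.f E.h (s.mem 8)) ≤ opTime lam d)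
    {Post : State Y → Prop}
    (h : ∀ t, t.time ≤ s.time + 90 * opTime lam d → t.coinsUsed = s.coinsUsed →
      t.targetQueries = s.targetQueries + 1 → (∀ i < 4, t.mem i = s.mem i) →
      t.mem 6 = s.mem 6 → t.mem 4 = s.mem 4 + 1 →
      t.mem 5 = s.mem 5 + score E.ℓ E.f E.h (s.mem 8) → Post t) :
    Runs E scoreStep s Post := by
  have hop : opTime lam d = 8 * lam + 2 * d + 32 := rfl
  have c0 : ∀ v < 64, numCost E.w v ≤ opTime lam d := fun v hv => cheap_of_lt_64 hv
  have cx : numCost E.w (s.mem 8) ≤ opTime lam d := cheap_of_lt hx (by omega)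
  have c1 : ∀ v ≤ 8 * 2 ^ (3 * lam), numCost E.w v ≤ opTime lam d := fun v hv =>
    cheap_of_lt (n := 3 * lam + 4) (by
      have : 2 ^ (3 * lam + 4) = 16 * 2 ^ (3 * lam) := by ring
      have : 0 < 2 ^ (3 * lam) := by positivity
      omega) (by omega)
  have hscore : (score E.ℓ E.f E.h (s.mem 8)) ≤ 8 := (score_bounds S.metric E.f _).1
  obtain ⟨D, hDe⟩ : ∃ D, E.ℓ (E.h false (point d (s.mem 8))) (E.h true (point d (s.mem 8))) = D :=
    ⟨_, rfl⟩
  obtain ⟨p, hpe⟩ : ∃ p, E.ℓ (E.f (point d (s.mem 8))) (E.h false (point d (s.mem 8))) = p :=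
    ⟨_, rfl⟩
  obtain ⟨q, hqe⟩ : ∃ q, E.ℓ (E.f (point d (s.mem 8))) (E.h true (point d (s.mem 8))) = q :=
    ⟨_, rfl⟩
  have hD : D ∈ PreciseRat lam := hDe ▸ S.metric.precise _ _
  have hp : p ∈ PreciseRat lam := hpe ▸ S.metric.precise _ _
  have hq : q ∈ PreciseRat lam := hqe ▸ S.metric.precise _ _
  have hs : 4 * (p.num.toNat * (q.den * D.den) + D.num.toNat * (p.den * q.den) -
      q.num.toNat * (p.den * D.den)) / (D.num.toNat * (p.den * q.den)) =
      score E.ℓ E.f E.h (s.mem 8) := by rw [score, hDe, hpe, hqe]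
  have mul₃ : ∀ {x y z : ℕ}, x ≤ 2 ^ lam → y ≤ 2 ^ lam → z ≤ 2 ^ lam →
      x * (y * z) ≤ 2 ^ (3 * lam) := by
    intro x y z hx hy hz
    calc x * (y * z) ≤ 2 ^ lam * (2 ^ lam * 2 ^ lam) :=
          Nat.mul_le_mul hx (Nat.mul_le_mul hy hz)
      _ = 2 ^ (3 * lam) := by rw [← pow_add, ← pow_add]; congr 1; ring
  have one : 1 ≤ 2 ^ lam := Nat.one_le_two_pow
  have mul₂ : ∀ {x y : ℕ}, x ≤ 2 ^ lam → y ≤ 2 ^ lam → x * y ≤ 2 ^ (3 * lam) := by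
    intro x y hx hy
    simpa using mul₃ one hx hy
  have ⟨hp₁, hp₂⟩ := PreciseRat.num_den_le hp
  have ⟨hq₁, hq₂⟩ := PreciseRat.num_den_le hq
  have ⟨hD₁, hD₂⟩ := PreciseRat.num_den_le hD
  have ⟨cp, cp'⟩ := cheap_precise (d := d) hp E.w
  have ⟨cq, cq'⟩ := cheap_precise (d := d) hq E.w
  have ⟨cD, cD'⟩ := cheap_precise (d := d) hD E.w
  have one' : 1 ≤ 2 ^ (3 * lam) := Nat.one_le_two_pow
  have m₁ := mul₂ hq₂ hD₂
  have m₂ := mul₂ hp₂ hq₂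
  have m₃ := mul₂ hp₂ hD₂
  have m₄ := mul₃ hp₁ hq₂ hD₂
  have m₅ := mul₃ hD₁ hp₂ hq₂
  have m₆ := mul₃ hq₁ hp₂ hD₂
  unfold scoreStep
  refine Runs.seq (Runs.queryHyp (H := opTime lam d) (c0 _ (by norm_num)) ?_ fun τ₁ hτ₁ => ?_)
  · simp [c0, cx]
  refine Runs.seq (Runs.queryHyp (H := opTime lam d) (c0 _ (by norm_num)) ?_ fun τ₂ hτ₂ => ?_)
  · simp [c0, cx]
  refine Runs.seq (Runs.queryTarget (H := opTime lam d) (c0 _ (by norm_num)) ?_ fun τ₃ hτ₃ => ?_)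
  · simp [c0, cx]
  refine Runs.seq (Runs.metric (H := opTime lam d) (c0 _ (by norm_num)) (c0 _ (by norm_num))
    (c0 _ (by norm_num)) (by simpa [metricVal] using hDe) cD cD' fun τ₄ hτ₄ => ?_)
  refine Runs.seq (Runs.metric (H := opTime lam d) (c0 _ (by norm_num)) (c0 _ (by norm_num))
    (c0 _ (by norm_num)) (by simpa [metricVal] using hpe) cp cp' fun τ₅ hτ₅ => ?_)
  refine Runs.seq (Runs.metric (H := opTime lam d) (c0 _ (by norm_num)) (c0 _ (by norm_num))
    (c0 _ (by norm_num)) (by simpa [metricVal] using hqe) cq cq' fun τ₆ hτ₆ => ?_)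
  refine Runs.seq (Runs.assign (H := opTime lam d) (c0 _ (by norm_num)) ?_ fun τ₇ hτ₇ => ?_)
  · simp [Expr.Cheap, Expr.eval, storeRat, c0, cp, cp', cq, cq', cD, cD', h5, hs, h5']
    (repeat' apply And.intro) <;> exact c1 _ (by omega)
  simp [Expr.nodes, Expr.eval, storeRat, hs] at hτ₁ hτ₂ hτ₃ hτ₄ hτ₅ hτ₆ hτ₇ ⊢
  refine Runs.assign (H := opTime lam d) (c0 _ (by norm_num)) ?_ fun τ₈ hτ₈ => ?_
  · simp [Expr.Cheap, Expr.eval, c0, h4, h4']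
  simp [Expr.nodes] at hτ₈
  refine h _ ?_ rfl rfl (fun i hi => ?_) ?_ ?_ ?_
  · dsimp only
    omega
  · simp [show i ≠ 4 by omega, show i ≠ 5 by omega, show i ≠ 21 by omega, show i ≠ 22 by omega,
      show i ≠ 23 by omega, show i ≠ 24 by omega, show i ≠ 25 by omega, show i ≠ 26 by omega]
  · simp
  · simp [Expr.eval]
  · simp

/-- The `j`-th block of `K` coins, read as a number. -/
def coinBlock (ω : ℕ → Bool) (K j : ℕ) : ℕ := Nat.ofBits fun i : Fin K => ω (j * K + i)

/-- The sum of the scores of the first `m` samples. -/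
def totalScore (lam : ℕ) (ℓ : Y → Y → ℚ) (Q : Cube d → ℚ) (f : Cube d → Y)
    (h : Bool → Cube d → Y) (ω : ℕ → Bool) (m : ℕ) : ℕ :=
  ∑ j ∈ Finset.range m, score ℓ f h (pick lam ℓ h Q (coinBlock ω (coinLen lam d) j))

theorem totalScore_le {ℓ : Y → Y → ℚ} (hℓ : IsPreciseMetric lam ℓ) (Q : Cube d → ℚ)
    (f : Cube d → Y) (h : Bool → Cube d → Y) (ω : ℕ → Bool) (m : ℕ) :
    totalScore lam ℓ Q f h ω m ≤ 8 * m := by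
  have := Finset.sum_le_card_nsmul (Finset.range m)
    (fun j => score ℓ f h (pick lam ℓ h Q (coinBlock ω (coinLen lam d) j))) 8
    fun j _ => (score_bounds hℓ f _).1
  simpa [totalScore, mul_comm] using this

/-- The invariant of the sampling loop, `s₀` being the configuration before the loop. -/
structure SampleInv (lam : ℕ) (E : Env Y d) (m : ℕ) (s₀ : State Y) (k : ℕ) (s : State Y) :
    Prop where
  dim : s.mem 0 = d
  samples : s.mem 3 = m
  total : s.mem 6 = prefixWeight lam E.ℓ E.h E.Q (2 ^ d)
  counter : s.mem 4 + k = m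
  sum : s.mem 5 = totalScore lam E.ℓ E.Q E.f E.h E.coins (s.mem 4)
  coins : s.coinsUsed = s.mem 4 * coinLen lam d
  queries : s.targetQueries = s.mem 4
  time : s.time + k * (200 * (d + 1) ^ 2 * opTime lam d) ≤
    s₀.time + m * (200 * (d + 1) ^ 2 * opTime lam d)

/-- Whatever the malicious prover says, the sampled point is a function of the coins alone, namely
`pick` of the current block. The counters must be cheap by the hypothesis `hw`, because `opTime`
does not depend on `β`. -/
theorem runs_sampleStep (S : Honest lam E b) {m : ℕ}
    (hw : ∀ v ≤ 8 * m, numCost E.w v ≤ opTime lam d) {s₀ s : State Y} {k : ℕ}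
    (hs : SampleInv lam E m s₀ (k + 1) s) {τ : ℕ} (hτ : τ ≤ s.time + 5 * opTime lam d) :
    Runs E (sampleStep lam) { s with time := τ } (SampleInv lam E m s₀ k) := by
  obtain ⟨dim, samples, total, counter, sum, coins, queries, time⟩ := hs
  have hop : opTime lam d = 8 * lam + 2 * d + 32 := rfl
  have hans : answerLen lam d = 4 * lam + d + 8 := rfl
  have hcoin : coinLen lam d = 4 * lam + d + 15 := rfl
  have hcoin' : d + (4 * lam + 15) = coinLen lam d := by omega
  have c0 : ∀ v < 64, numCost E.w v ≤ opTime lam d := fun v hv => cheap_of_lt_64 hv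
  have c1 : ∀ v ≤ 2 ^ (d + 1), numCost E.w v ≤ opTime lam d := fun v hv =>
    cheap_of_lt (hv.trans_lt (two_pow_lt_two_pow_succ (d + 1))) (by omega)
  have c2 : ∀ v < 2 ^ (answerLen lam d + coinLen lam d), numCost E.w v ≤ opTime lam d :=
    fun v hv => cheap_of_lt hv (by omega)
  have c3 : ∀ v ≤ opTime lam d, numCost E.w v ≤ opTime lam d := fun v hv => cheap_of_le hv
  have hd := two_pow_lt_two_pow_succ d
  have htime : (k + 1) * (200 * (d + 1) ^ 2 * opTime lam d) =
    k * (200 * (d + 1) ^ 2 * opTime lam d) + 200 * (d + 1) ^ 2 * opTime lam d := by ring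
  have htime' : 200 * (d + 1) ^ 2 * opTime lam d =
    d * (200 * (d + 1) * opTime lam d) + (200 * d + 200) * opTime lam d := by ring
  have htime'' : 200 * opTime lam d ≤ (200 * d + 200) * opTime lam d :=
    Nat.mul_le_mul_right _ (by omega)
  have hr : coinBlock E.coins (coinLen lam d) (s.mem 4) < 2 ^ coinLen lam d := Nat.ofBits_lt_two_pow _
  have hT : prefixWeight lam E.ℓ E.h E.Q (2 ^ d) < 2 ^ answerLen lam d :=
    prefixWeight_lt S.metric S.dist le_rfl
  have hu : coinBlock E.coins (coinLen lam d) (s.mem 4) * prefixWeight lam E.ℓ E.h E.Q (2 ^ d) <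
      2 ^ (answerLen lam d + coinLen lam d) := by
    rw [add_comm (answerLen lam d), pow_add]
    exact Nat.mul_lt_mul'' hr hT
  have cr : numCost E.w (coinBlock E.coins (coinLen lam d) (s.mem 4)) ≤ opTime lam d :=
    cheap_of_lt hr (by omega)
  have cT : numCost E.w (prefixWeight lam E.ℓ E.h E.Q (2 ^ d)) ≤ opTime lam d :=
    cheap_of_lt hT (by omega)
  have hsum := totalScore_le S.metric E.Q E.f E.h E.coins (s.mem 4)
  have hblock : (Nat.ofBits fun i : Fin (coinLen lam d) => E.coins (s.coinsUsed + i)) =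
      coinBlock E.coins (coinLen lam d) (s.mem 4) := by
    rw [coinBlock, coins]
  unfold sampleStep
  refine Runs.seq (Runs.toss (H := opTime lam d) (N := coinLen lam d)
    (by simp [Expr.eval, dim, hcoin']) (c0 _ (by norm_num)) ?_ fun τ₁ hτ₁ => ?_)
  · simp [Expr.Cheap, Expr.eval, c0, dim, hcoin']
    exact ⟨c3 _ (by omega), c3 _ (by omega), c3 _ (by omega)⟩
  simp only [Expr.nodes, cell_nodes] at hτ₁
  rw [hblock]
  refine Runs.seq (Runs.assign (H := opTime lam d) (c0 _ (by norm_num)) ?_ fun τ₂ hτ₂ => ?_)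
  · simp [Expr.Cheap, c0, total, cr, cT]
    exact c2 _ hu
  refine Runs.seq (Runs.assign (H := opTime lam d) (c0 _ (by norm_num)) ?_ fun τ₃ hτ₃ => ?_)
  · exact c0 _ (by norm_num)
  refine Runs.seq (Runs.assign (H := opTime lam d) (c0 _ (by norm_num)) ?_ fun τ₄ hτ₄ => ?_)
  · simp [Expr.Cheap, Expr.eval, c0, dim]
    exact ⟨c3 _ (by omega), c1 _ (by omega)⟩
  simp [Expr.nodes, Expr.eval, dim, total] at hτ₂ hτ₃ hτ₄ ⊢
  generalize hs₁ : State.mk (Y := Y) _ _ _ _ _ _ = s₁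
  have h7 : s₁.mem 7 = coinBlock E.coins (coinLen lam d) (s.mem 4) *
      prefixWeight lam E.ℓ E.h E.Q (2 ^ d) := by subst hs₁; simp
  have frame : ∀ i < 7, s₁.mem i = s.mem i := by
    intro i hi
    subst hs₁
    simp [show i ≠ 7 by omega, show i ≠ 8 by omega, show i ≠ 9 by omega]
  have f0 : s₁.mem 0 = d := by rw [frame 0 (by norm_num), dim]
  have hinv : SearchInv lam E s₁ d s₁ := by
    constructor <;> subst hs₁ <;> simp [prefixWeight_zero]
  have hcoins : s₁.coinsUsed = s.coinsUsed + coinLen lam d := by subst hs₁; rfl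
  have hqueries : s₁.targetQueries = s.targetQueries := by subst hs₁; rfl
  have htime₁ : s₁.time ≤ s.time + 40 * opTime lam d := by subst hs₁; dsimp only; omega
  refine Runs.seq (Runs.whileLt (H := opTime lam d) (SearchInv lam E s₁) one_le_opTime ?_ ?_ ?_ ?_
    d hinv)
  · intro k u hu
    have := hu.lt
    have := hu.le
    simp [Expr.Cheap, Expr.eval, c0]
    exact ⟨⟨c1 _ (by omega), c1 _ (by omega)⟩, c1 _ (by omega)⟩
  · intro u hu
    have := hu.width
    simp [Expr.eval]
    omega
  · intro k u hu' hlt τ' hτ'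
    exact runs_searchStep S f0 (h7 ▸ hu) hu' hlt hτ'
  · intro k' u hu' hlt τ' hτ'
    simp [Expr.eval, Expr.nodes] at hlt hτ'
    have hlt' := hu'.lt
    have hle := hu'.le
    have htu := hu'.time
    -- On exit the search interval is a single point, which `eq_pick` identifies.
    have h9 : u.mem 9 = u.mem 8 + 1 := by omega
    have hpick : u.mem 8 = pick lam E.ℓ E.h E.Q (coinBlock E.coins (coinLen lam d) (s.mem 4)) := by
      refine eq_pick (by omega) (h7 ▸ hu'.low) ?_
      rw [← h9, ← h7]
      exact hu'.high
    have f4 : u.mem 4 = s.mem 4 := (hu'.frame 4 (by norm_num)).trans (frame 4 (by norm_num))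
    have f5 : u.mem 5 = s.mem 5 := (hu'.frame 5 (by norm_num)).trans (frame 5 (by norm_num))
    have hsucc : totalScore lam E.ℓ E.Q E.f E.h E.coins (s.mem 4 + 1) =
        totalScore lam E.ℓ E.Q E.f E.h E.coins (s.mem 4) + score E.ℓ E.f E.h (u.mem 8) := by
      rw [totalScore, Finset.sum_range_succ, ← hpick, totalScore]
    have hsum' := totalScore_le S.metric E.Q E.f E.h E.coins (s.mem 4 + 1)
    refine runs_scoreStep S (s := { u with time := τ' }) ?_ ?_ ?_ ?_ ?_
      fun t ht₁ ht₂ ht₃ ht₄ ht₅ ht₆ ht₇ => ?_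
    · dsimp only
      omega
    · dsimp only
      exact hw _ (by omega)
    · dsimp only
      exact hw _ (by omega)
    · dsimp only
      exact hw _ (by omega)
    · dsimp only
      exact hw _ (by omega)
    · dsimp only at ht₁ ht₂ ht₃ ht₄ ht₅ ht₆ ht₇
      constructor
      · rw [ht₄ 0 (by norm_num), hu'.frame 0 (by norm_num), f0]
      · rw [ht₄ 3 (by norm_num), hu'.frame 3 (by norm_num), frame 3 (by norm_num), samples]
      · rw [ht₅, hu'.frame 6 (by norm_num), frame 6 (by norm_num), total]
      · omega
      · rw [ht₆, f4, hsucc, ht₇, f5, sum]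
      · rw [ht₂, hu'.coins, hcoins, coins, ht₆, f4, add_mul, one_mul]
      · rw [ht₃, hu'.queries, hqueries, queries, ht₆, f4]
      · omega

theorem runs_verifier (S : Honest lam E b) {lb : ℕ}
    (hw : ∀ v ≤ 256 * lb, numCost E.w v ≤ opTime lam d) {s : State Y} (h0 : s.mem 0 = d)
    (h2 : s.mem 2 = lb) (h4 : s.mem 4 = 0) (h5 : s.mem 5 = 0) (hc : s.coinsUsed = 0)
    (hq : s.targetQueries = 0) :
    Runs E (verifier lam) s fun t =>
      t.time ≤ s.time + 6400 * (lb + 1) * (d + 1) ^ 2 * opTime lam d ∧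
      t.targetQueries = (if lb < 2 then 0 else 32 * lb) ∧
      t.output = if lb < 2 then E.coins 0 else
        decide (4 * (32 * lb) ≤ totalScore lam E.ℓ E.Q E.f E.h E.coins (32 * lb)) := by
  have hop : opTime lam d = 8 * lam + 2 * d + 32 := rfl
  have hans : answerLen lam d = 4 * lam + d + 8 := rfl
  have c0 : ∀ v < 64, numCost E.w v ≤ opTime lam d := fun v hv => cheap_of_lt_64 hv
  have c1 : ∀ v ≤ 2 ^ (d + 1), numCost E.w v ≤ opTime lam d := fun v hv =>
    cheap_of_lt (hv.trans_lt (two_pow_lt_two_pow_succ (d + 1))) (by omega)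
  have c3 : ∀ v ≤ opTime lam d, numCost E.w v ≤ opTime lam d := fun v hv => cheap_of_le hv
  have hd := two_pow_lt_two_pow_succ d
  have hT : prefixWeight lam E.ℓ E.h E.Q (2 ^ d) < 2 ^ answerLen lam d :=
    prefixWeight_lt S.metric S.dist le_rfl
  have cT : numCost E.w (prefixWeight lam E.ℓ E.h E.Q (2 ^ d)) ≤ opTime lam d :=
    cheap_of_lt hT (by omega)
  -- There are `32 * lb` samples at `200 * (d + 1) ^ 2 * opTime lam d` each; the remaining term pays
  -- for the total weight and the bookkeeping.
  have b₁ : 6400 * (lb + 1) * (d + 1) ^ 2 * opTime lam d =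
      32 * lb * (200 * (d + 1) ^ 2 * opTime lam d) +
        (6400 * (d + 1) ^ 2) * opTime lam d := by ring
  have b₂ : 160 * (d + 1) * opTime lam d + 6240 * opTime lam d ≤
      (6400 * (d + 1) ^ 2) * opTime lam d := by
    rw [← add_mul]
    exact Nat.mul_le_mul_right _ (by nlinarith)
  unfold verifier
  refine Runs.ifLt (H := opTime lam d) one_le_opTime ?_ ?_ (fun hlt τ hτ => ?_)
    (fun hlt τ hτ => ?_)
  · simp [c0, h2, hw _ (show lb ≤ 256 * lb by omega)]
  · exact c0 _ (by norm_num)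
  · simp [Expr.eval, Expr.nodes, h2] at hlt hτ
    have hlt' : lb < 2 := by omega
    refine Runs.toss (H := opTime lam d) (N := 1) rfl (c0 _ (by norm_num)) (c0 _ (by norm_num))
      fun τ₁ hτ₁ => ?_
    simp only [Expr.nodes] at hτ₁
    refine ⟨?_, ?_, ?_⟩
    · dsimp only
      omega
    · simp [hlt', hq]
    · simp [hlt', State.output, hc, Nat.ofBits]
      cases E.coins 0 <;> rfl
  · simp [Expr.eval, Expr.nodes, h2] at hlt hτ
    have hlt' : ¬ lb < 2 := by omega
    simp only [hlt', if_false]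
    refine Runs.seq (Runs.assign (H := opTime lam d) (c0 _ (by norm_num)) ?_ fun τ₁ hτ₁ => ?_)
    · simp [Expr.Cheap, Expr.eval, c0, h2]
      exact ⟨hw _ (by omega), hw _ (by omega)⟩
    refine Runs.seq (Runs.assign (H := opTime lam d) (c0 _ (by norm_num)) ?_ fun τ₂ hτ₂ => ?_)
    · simp [Expr.Cheap, Expr.eval, c0, h0]
      exact ⟨c3 _ (by omega), c1 _ (by omega)⟩
    simp [Expr.nodes, Expr.eval, h0, h2] at hτ₁ hτ₂ ⊢
    refine Runs.seq (runs_getWeight S ?_ ?_ ?_ fun t ht hmem hval => ?_)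
    · simp [h0]
    · simp [Nat.one_le_two_pow]
    · simp
    simp only [Function.update_self] at hval
    have t0 : t.mem 0 = d := by simp [hmem 0 (by norm_num), h0]
    have t3 : t.mem 3 = 32 * lb := by simp [hmem 3 (by norm_num)]
    have t4 : t.mem 4 = 0 := by simp [hmem 4 (by norm_num), h4]
    have t5 : t.mem 5 = 0 := by simp [hmem 5 (by norm_num), h5]
    have t₁ := ht.time
    have t₂ := ht.coins
    have t₃ := ht.queries
    dsimp only at t₁ t₂ t₃
    refine Runs.seq (Runs.assign (H := opTime lam d) (c0 _ (by norm_num)) ?_ fun τ₃ hτ₃ => ?_)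
    · simp [c0, hval, cT]
    simp [hval] at hτ₃ ⊢
    generalize hs₁ : State.mk (Y := Y) _ _ _ _ _ _ = s₁
    have hinv : SampleInv lam E (32 * lb) s₁ (32 * lb) s₁ := by
      constructor <;> subst hs₁ <;> simp [t0, t3, t4, t5, t₂, t₃, hc, hq, totalScore]
    have htime₁ : s₁.time ≤ s.time + 160 * (d + 1) * opTime lam d + 20 * opTime lam d := by
      subst hs₁
      dsimp only
      omega
    refine Runs.seq (Runs.whileLt (H := opTime lam d) (SampleInv lam E (32 * lb) s₁) one_le_opTime
      ?_ ?_ ?_ ?_ (32 * lb) hinv)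
    · intro k u hu
      have := hu.counter
      have := hu.samples
      simp [c0]
      exact ⟨hw _ (by omega), hw _ (by omega)⟩
    · intro u hu
      have := hu.counter
      have := hu.samples
      simp
      omega
    · intro k u hu _ τ' hτ'
      exact runs_sampleStep S (fun v hv => hw v (by omega)) hu hτ'
    · intro k u hu hlt τ' hτ'
      simp at hlt hτ'
      have hk := hu.counter
      have h3 := hu.samples
      have h4' : u.mem 4 = 32 * lb := by omega
      have hsum := hu.sum
      have hsum' := totalScore_le S.metric E.Q E.f E.h E.coins (32 * lb)
      have htu := hu.time
      rw [h4'] at hsum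
      refine Runs.ifLt (H := opTime lam d) one_le_opTime ?_ ?_ (fun hc' τ₄ hτ₄ => ?_)
        (fun hc' τ₄ hτ₄ => ?_)
      · simp [c0]
        exact hw _ (by omega)
      · simp [Expr.Cheap, Expr.eval, c0]
        exact ⟨hw _ (by omega), hw _ (by omega)⟩
      · simp [Expr.eval, Expr.nodes] at hc' hτ₄
        refine Runs.assign (H := opTime lam d) (c0 _ (by norm_num)) (c0 _ (by norm_num))
          fun τ₅ hτ₅ => ⟨?_, ?_, ?_⟩
        · simp [Expr.nodes] at hτ₅
          dsimp only
          omega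
        · exact hu.queries.trans h4'
        · have : ¬ 4 * (32 * lb) ≤ totalScore lam E.ℓ E.Q E.f E.h E.coins (32 * lb) := by omega
          simp [State.output, Expr.eval, this]
      · simp [Expr.eval, Expr.nodes] at hc' hτ₄
        refine Runs.assign (H := opTime lam d) (c0 _ (by norm_num)) (c0 _ (by norm_num))
          fun τ₅ hτ₅ => ⟨?_, ?_, ?_⟩
        · simp [Expr.nodes] at hτ₅
          dsimp only
          omega
        · exact hu.queries.trans h4'
        · have : 4 * (32 * lb) ≤ totalScore lam E.ℓ E.Q E.f E.h E.coins (32 * lb) := by omega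
          simp [State.output, Expr.eval, this]

end RefereedLearning

namespace RefereedLearning

/-! ### The distribution of the samples -/

section Sampling

/-- An interval of length `B - A` contains at most `(B - A) / T + 1` multiples of `T`. -/
theorem card_mul_le {N A B T : ℕ} (hT : 0 < T) (hAB : A ≤ B) :
    ((Finset.range N).filter fun r => A ≤ r * T ∧ r * T < B).card * T ≤ (B - A) + T := by
  have hsub : ((Finset.range N).filter fun r => A ≤ r * T ∧ r * T < B) ⊆
      Finset.Ico ((A + T - 1) / T) ((B + T - 1) / T) := by
    intro r hr
    simp only [Finset.mem_filter, Finset.mem_range] at hr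
    obtain ⟨-, h₁, h₂⟩ := hr
    rw [Finset.mem_Ico]
    constructor
    · rw [← Nat.lt_add_one_iff, Nat.div_lt_iff_lt_mul hT, add_mul, one_mul]
      omega
    · rw [← Nat.add_one_le_iff, Nat.le_div_iff_mul_le hT, add_mul, one_mul]
      omega
  have hcard := Finset.card_le_card hsub
  rw [Nat.card_Ico] at hcard
  have h₁ : (B + T - 1) / T * T ≤ B + T - 1 := Nat.div_mul_le_self _ _
  have h₂ : A + T - 1 < (A + T - 1) / T * T + T := Nat.lt_div_mul_add hT
  calc _ ≤ ((B + T - 1) / T - (A + T - 1) / T) * T := Nat.mul_le_mul_right _ hcard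
    _ = (B + T - 1) / T * T - (A + T - 1) / T * T := Nat.sub_mul _ _ _
    _ ≤ _ := by omega

variable {Y : Type*} {d lam : ℕ} {ℓ : Y → Y → ℚ} {h : Bool → Cube d → Y} {Q : Cube d → ℚ}

/-- Up to the factor `129/128`, no point is sampled more often than its weight warrants. An upper
bound suffices, since only means of nonnegative functions have to be bounded from above. -/
theorem card_pick_mul_le (hℓ : IsPreciseMetric lam ℓ) (hQ : Q ∈ PreciseDist d lam)
    (hT : 0 < prefixWeight lam ℓ h Q (2 ^ d)) (x : ℕ) :
    128 * (((Finset.range (2 ^ coinLen lam d)).filter fun r => pick lam ℓ h Q r = x).card *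
      prefixWeight lam ℓ h Q (2 ^ d)) ≤ 129 * (weight lam ℓ h Q x * 2 ^ coinLen lam d) := by
  have hsucc := prefixWeight_succ (lam := lam) (ℓ := ℓ) (h := h) (Q := Q) x
  have hlt := prefixWeight_lt (h := h) hℓ hQ (le_refl (2 ^ d))
  -- The seven coins beyond `answerLen` make the additive error `T` in the count at most `N / 128`.
  have hN : 2 ^ coinLen lam d = 128 * 2 ^ answerLen lam d := by
    unfold coinLen answerLen
    ring
  set T := prefixWeight lam ℓ h Q (2 ^ d) with hTdef
  set A := prefixWeight lam ℓ h Q x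
  set B := prefixWeight lam ℓ h Q (x + 1)
  set W := weight lam ℓ h Q x
  set N := 2 ^ coinLen lam d with hNdef
  have hsub : ((Finset.range N).filter fun r => pick lam ℓ h Q r = x) ⊆
      (Finset.range N).filter fun r => A * N ≤ r * T ∧ r * T < B * N := by
    intro r hr
    simp only [Finset.mem_filter, Finset.mem_range] at hr ⊢
    obtain ⟨hr, rfl⟩ := hr
    have hspec := pick_spec (lam := lam) (ℓ := ℓ) (h := h) (Q := Q) r
    refine ⟨hr, hspec.1, ?_⟩
    rcases hspec.2 with h₂ | h₂
    · have : B = T := by rw [hTdef, ← h₂]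
      rw [this, mul_comm]
      exact Nat.mul_lt_mul_of_pos_left hr hT
    · exact h₂
  have hle : A * N ≤ B * N := Nat.mul_le_mul_right _ (by omega)
  have hcount := card_mul_le (N := N) hT hle
  have hcard := Nat.mul_le_mul_right T (Finset.card_le_card hsub)
  have hBA : B * N - A * N = W * N := by rw [hsucc, add_mul]; omega
  -- A point of weight `0` is never drawn. Any other has weight at least `1`, so the error `N / 128`
  -- is relative to `W * N`.
  rcases Nat.eq_zero_or_pos W with h0 | h0
  · have : ((Finset.range N).filter fun r => A * N ≤ r * T ∧ r * T < B * N) = ∅ := by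
      refine Finset.filter_false_of_mem fun r _ => ?_
      rw [hsucc, h0, add_zero]
      omega
    rw [this, Finset.card_empty, zero_mul] at hcard
    omega
  · have hWN : N ≤ W * N := Nat.le_mul_of_pos_left _ h0
    omega

theorem sum_pick_mul_le (hℓ : IsPreciseMetric lam ℓ) (hQ : Q ∈ PreciseDist d lam)
    (hT : 0 < prefixWeight lam ℓ h Q (2 ^ d)) {g : ℕ → ℚ} (hg : ∀ x, 0 ≤ g x) :
    128 * ((∑ r ∈ Finset.range (2 ^ coinLen lam d), g (pick lam ℓ h Q r)) *
      prefixWeight lam ℓ h Q (2 ^ d)) ≤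
    129 * (2 ^ coinLen lam d * ∑ x ∈ Finset.range (2 ^ d), weight lam ℓ h Q x * g x) := by
  have hfib : ∑ r ∈ Finset.range (2 ^ coinLen lam d), g (pick lam ℓ h Q r) =
      ∑ x ∈ Finset.range (2 ^ d),
        (((Finset.range (2 ^ coinLen lam d)).filter fun r => pick lam ℓ h Q r = x).card : ℚ)
          * g x := by
    rw [← Finset.sum_fiberwise_of_maps_to (s := Finset.range (2 ^ coinLen lam d))
      (t := Finset.range (2 ^ d)) (g := pick lam ℓ h Q)
      fun r _ => Finset.mem_range.2 (pick_lt r)]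
    refine Finset.sum_congr rfl fun x _ => ?_
    rw [Finset.sum_congr rfl (g := fun _ => g x) fun r hr => by
      rw [(Finset.mem_filter.1 hr).2]]
    rw [Finset.sum_const, nsmul_eq_mul]
  rw [hfib, Finset.sum_mul, Finset.mul_sum, Finset.mul_sum, Finset.mul_sum]
  refine Finset.sum_le_sum fun x _ => ?_
  have h₁ : (128 * ((((Finset.range (2 ^ coinLen lam d)).filter
      fun r => pick lam ℓ h Q r = x).card : ℚ) * (prefixWeight lam ℓ h Q (2 ^ d) : ℚ))) ≤
      129 * ((weight lam ℓ h Q x : ℚ) * 2 ^ coinLen lam d) := by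
    exact_mod_cast card_pick_mul_le hℓ hQ hT x
  linarith [mul_le_mul_of_nonneg_right h₁ (hg x)]

theorem PreciseRat.one_le_mul {r : ℚ} (hr : r ∈ PreciseRat lam) (h0 : 0 < r) :
    1 ≤ r * 2 ^ lam := by
  have h₁ : (1 : ℚ) ≤ r * r.den := by
    rw [Rat.mul_den_eq_num]
    exact_mod_cast Rat.num_pos.2 h0
  have h₂ : (r.den : ℚ) ≤ 2 ^ lam := by exact_mod_cast (PreciseRat.num_den_le hr).2
  nlinarith

/-- A nonzero product of mass and distance is at least `2 ^ -(2 * lam)`, hence at least `128` after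
scaling, and rounding down costs at most `1/128` of it. -/
theorem weight_bounds (hℓ : IsPreciseMetric lam ℓ) (hQ : Q ∈ PreciseDist d lam) (x : ℕ) :
    (weight lam ℓ h Q x : ℚ) ≤ 2 ^ (2 * lam + 7) *
      (Q (point d x) * ℓ (h false (point d x)) (h true (point d x))) ∧
    127 * (2 ^ (2 * lam + 7) * (Q (point d x) * ℓ (h false (point d x)) (h true (point d x)))) ≤
      128 * (weight lam ℓ h Q x : ℚ) := by
  unfold weight
  have hq := hQ.2.2 (point d x)
  have hD := hℓ.precise (h false (point d x)) (h true (point d x))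
  have hq0 := hQ.1 (point d x)
  have hD0 := hℓ.nonneg (h false (point d x)) (h true (point d x))
  generalize Q (point d x) = q at *
  generalize ℓ (h false (point d x)) (h true (point d x)) = D at *
  have pq : (0 : ℚ) < q.den := by exact_mod_cast q.den_pos
  have pD : (0 : ℚ) < D.den := by exact_mod_cast D.den_pos
  have hB : 0 < q.den * D.den := Nat.mul_pos q.den_pos D.den_pos
  have hA : ((q.num.toNat * D.num.toNat * 2 ^ (2 * lam + 7) : ℕ) : ℚ) =
      2 ^ (2 * lam + 7) * (q * D) * (q.den * D.den) := by
    push_cast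
    rw [cast_num_den hq0, cast_num_den hD0]
    ring
  have hB' : ((q.den * D.den : ℕ) : ℚ) = q.den * D.den := by push_cast; rfl
  have hBpos : (0 : ℚ) < (q.den : ℚ) * D.den := by positivity
  generalize q.num.toNat * D.num.toNat * 2 ^ (2 * lam + 7) = A at *
  generalize q.den * D.den = B at *
  have l₁ : ((A / B : ℕ) : ℚ) * B ≤ A := (cast_div_le_iff hB).1 le_rfl
  have l₂ : (A : ℚ) < ((A / B : ℕ) + 1) * B := by
    have := Nat.lt_div_mul_add (a := A) hB
    have : A < (A / B + 1) * B := by rw [add_mul, one_mul]; exact this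
    exact_mod_cast this
  rw [hA, hB'] at l₁ l₂
  have l₁ := le_of_mul_le_mul_right l₁ hBpos
  have l₂ := lt_of_mul_lt_mul_right l₂ hBpos.le
  refine ⟨l₁, ?_⟩
  rcases (mul_nonneg hq0 hD0).eq_or_lt with h0 | h0
  · rw [← h0]
    simp
  · have hq1 : 0 < q := hq0.lt_of_ne fun h => by rw [← h, zero_mul] at h0; exact h0.false
    have hD1 : 0 < D := hD0.lt_of_ne fun h => by rw [← h, mul_zero] at h0; exact h0.false
    have h₁ := PreciseRat.one_le_mul hq hq1
    have h₂ := PreciseRat.one_le_mul hD hD1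
    have h₃ : (128 : ℚ) ≤ 2 ^ (2 * lam + 7) * (q * D) := by
      have := one_le_mul_of_one_le_of_one_le h₁ h₂
      calc (128 : ℚ) ≤ 128 * (q * 2 ^ lam * (D * 2 ^ lam)) := by linarith
        _ = _ := by ring
    linarith

theorem point_ofBits {K : ℕ} (v : Cube K) : point K (Nat.ofBits v) = v := by
  funext i
  simp [point, Nat.testBit_ofBits_lt]

theorem sum_cube {M : Type*} [AddCommMonoid M] {K : ℕ} (g : ℕ → M) :
    ∑ v : Cube K, g (Nat.ofBits v) = ∑ n ∈ Finset.range (2 ^ K), g n := by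
  have hinj : Function.Injective fun v : Cube K => (⟨Nat.ofBits v, Nat.ofBits_lt_two_pow v⟩ :
      Fin (2 ^ K)) := by
    intro v v' hv
    rw [← point_ofBits v, ← point_ofBits v', Fin.mk.inj hv]
  have hbij := (Fintype.bijective_iff_injective_and_card _).2 ⟨hinj, by simp⟩
  rw [Finset.sum_range]
  exact Fintype.sum_bijective _ hbij _ _ fun _ => rfl

theorem sum_point {M : Type*} [AddCommMonoid M] (g : Cube d → M) :
    ∑ n ∈ Finset.range (2 ^ d), g (point d n) = ∑ v, g v := by
  rw [← sum_cube]
  simp [point_ofBits]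

/-- If the mean of `g` under the exact weights is at most `3`, then the mean of `g` at the sampled
points is at most `99 / 32`. -/
theorem sum_pick_le (hℓ : IsPreciseMetric lam ℓ) (hQ : Q ∈ PreciseDist d lam) {g : Cube d → ℚ}
    (hg : ∀ x, 0 ≤ g x) (hZ : 0 < ∑ x, Q x * ℓ (h false x) (h true x))
    (hmean : ∑ x, Q x * ℓ (h false x) (h true x) * g x ≤
      3 * ∑ x, Q x * ℓ (h false x) (h true x)) :
    ∑ r ∈ Finset.range (2 ^ coinLen lam d), g (point d (pick lam ℓ h Q r)) ≤
      99 / 32 * 2 ^ coinLen lam d := by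
  have hlow : 127 * (2 ^ (2 * lam + 7) * ∑ x, Q x * ℓ (h false x) (h true x)) ≤
      128 * (prefixWeight lam ℓ h Q (2 ^ d) : ℚ) := by
    rw [← sum_point, prefixWeight, Nat.cast_sum, Finset.mul_sum, Finset.mul_sum, Finset.mul_sum]
    exact Finset.sum_le_sum fun x _ => (weight_bounds hℓ hQ x).2
  have hhigh : ∑ x ∈ Finset.range (2 ^ d), (weight lam ℓ h Q x : ℚ) * g (point d x) ≤
      2 ^ (2 * lam + 7) * ∑ x, Q x * ℓ (h false x) (h true x) * g x := by
    rw [← sum_point, Finset.mul_sum]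
    refine Finset.sum_le_sum fun x _ => ?_
    rw [← mul_assoc]
    exact mul_le_mul_of_nonneg_right (weight_bounds hℓ hQ x).1 (hg _)
  have hM : (0 : ℚ) < 2 ^ (2 * lam + 7) := by positivity
  have hN : (0 : ℚ) < 2 ^ coinLen lam d := by positivity
  have hTpos : (0 : ℚ) < prefixWeight lam ℓ h Q (2 ^ d) := by
    have := mul_pos hM hZ
    linarith
  have hmain := sum_pick_mul_le hℓ hQ (by exact_mod_cast hTpos) (g := fun x => g (point d x))
    fun x => hg _
  have h₁ := mul_le_mul_of_nonneg_left hmean hM.le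
  -- Rounded weights raise the mean to `3 * 128 / 127`; the factor `129 / 128` from the coins makes
  -- it `387 / 127`, which is below `99 / 32`.
  have h₂ : ∑ x ∈ Finset.range (2 ^ d), (weight lam ℓ h Q x : ℚ) * g (point d x) ≤
      384 / 127 * (prefixWeight lam ℓ h Q (2 ^ d) : ℚ) := by linarith
  have h₃ := mul_le_mul_of_nonneg_left h₂ hN.le
  have h₄ : 0 ≤ 2 ^ coinLen lam d * (prefixWeight lam ℓ h Q (2 ^ d) : ℚ) := by positivity
  refine le_of_mul_le_mul_right ?_ hTpos
  linarith

end Sampling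

end RefereedLearning

/-! ### Fair coins and the Chernoff bound. -/

namespace RefereedLearning

open MeasureTheory

instance : IsProbabilityMeasure coinLaw := by
  unfold coinLaw
  infer_instance

/-- The first `n` coins have any given values with probability `2 ^ -n`. -/
theorem coinLaw_prefix (n : ℕ) (c : ℕ → Bool) :
    coinLaw {ω | ∀ i < n, ω i = c i} = 2⁻¹ ^ n := by
  have hset : {ω : ℕ → Bool | ∀ i < n, ω i = c i} =
      Set.pi (Finset.range n : Set ℕ) fun i => {c i} := by
    ext ω
    simp [Set.mem_pi]
  rw [hset, coinLaw, Measure.infinitePi_pi _ fun _ _ => measurableSet_singleton _]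
  simp

/-- An event that is determined by the first `m` blocks of `K` coins has the probability with which
it occurs for `m` uniformly random blocks. -/
theorem coinLaw_blocks_le (m K : ℕ) (B : Set (Fin m → Cube K)) [DecidablePred (· ∈ B)] :
    coinLaw {ω | (fun (j : Fin m) (i : Fin K) => ω (j * K + i)) ∈ B} ≤
      ENNReal.ofReal (((Finset.univ.filter (· ∈ B)).card : ℝ) / (2 ^ K) ^ m) := by
  have hcover : {ω : ℕ → Bool | (fun (j : Fin m) (i : Fin K) => ω (j * K + i)) ∈ B} ⊆
      ⋃ c ∈ Finset.univ.filter (· ∈ B), {ω | (fun (j : Fin m) (i : Fin K) => ω (j * K + i)) = c} := by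
    intro ω hω
    simpa using hω
  have hone : ∀ c : Fin m → Cube K,
      coinLaw {ω | (fun (j : Fin m) (i : Fin K) => ω (j * K + i)) = c} ≤ 2⁻¹ ^ (m * K) := by
    intro c
    -- Coin `n` is coin `n % K` of block `n / K`, so a realisation `ω₀` of `c` fixes the first `m *
    -- K` coins. A pattern `c` without a realisation has an empty event.
    by_cases hne : ∃ ω₀ : ℕ → Bool, (fun (j : Fin m) (i : Fin K) => ω₀ (j * K + i)) = c
    · obtain ⟨ω₀, rfl⟩ := hne
      rw [← coinLaw_prefix (m * K) ω₀]
      refine measure_mono fun ω hω n hn => ?_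
      have hK : 0 < K := Nat.pos_of_ne_zero fun h => by simp [h] at hn
      have hj : n / K < m := (Nat.div_lt_iff_lt_mul hK).2 hn
      have := congrFun (congrFun hω ⟨n / K, hj⟩) ⟨n % K, Nat.mod_lt _ hK⟩
      simpa [Nat.div_add_mod'] using this
    · have : {ω : ℕ → Bool | (fun (j : Fin m) (i : Fin K) => ω (j * K + i)) = c} = ∅ :=
        Set.eq_empty_iff_forall_notMem.2 fun ω hω => hne ⟨ω, hω⟩
      rw [this]
      simp
  calc _ ≤ ∑ c ∈ Finset.univ.filter (· ∈ B),
        coinLaw {ω | (fun (j : Fin m) (i : Fin K) => ω (j * K + i)) = c} :=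
        (measure_mono hcover).trans (measure_biUnion_finset_le _ _)
    _ ≤ ∑ _c ∈ Finset.univ.filter (· ∈ B), (2⁻¹ : ENNReal) ^ (m * K) :=
        Finset.sum_le_sum fun c _ => hone c
    _ = _ := by
        rw [Finset.sum_const, nsmul_eq_mul, div_eq_mul_inv, ENNReal.ofReal_mul (by positivity),
          ENNReal.ofReal_natCast, ← pow_mul, ← inv_pow, ENNReal.ofReal_pow (by positivity),
          ENNReal.ofReal_inv_of_pos (by norm_num), mul_comm m K]
        simp

/-- A Chernoff bound for sums of independent variables with values in `{0, …, 8}` whose mean is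
at most `99 / 32`. -/
theorem chernoff {lb K : ℕ} {φ : ℕ → ℕ} (hφ : ∀ r, φ r ≤ 8)
    (hmean : 32 * ∑ r ∈ Finset.range (2 ^ K), φ r ≤ 99 * 2 ^ K) :
    coinLaw {ω | 4 * (32 * lb) ≤ ∑ j ∈ Finset.range (32 * lb), φ (coinBlock ω K j)} ≤
      ENNReal.ofReal ((1 / 2) ^ lb) := by
  classical
  have hmean : ∑ r ∈ Finset.range (2 ^ K), (φ r : ℝ) ≤ 99 / 32 * 2 ^ K := by
    have : (32 * ∑ r ∈ Finset.range (2 ^ K), (φ r : ℝ)) ≤ 99 * 2 ^ K := by exact_mod_cast hmean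
    linarith
  set m := 32 * lb with hm
  -- The base of the exponential moment. Any fixed `z > 1` with `(1 + 99 / 32 * (z ^ 8 - 1) / 8) ^
  -- 32 ≤ z ^ 128 / 2` would do.
  set z : ℝ := 21 / 20 with hz
  have hmoment : ∑ r ∈ Finset.range (2 ^ K), z ^ φ r ≤ 2 ^ K * (1185 / 1000) := by
    -- By convexity `z ^ n` lies below its chord over `[0, 8]`, so the moment is controlled by the
    -- mean.
    have hconv : ∀ n : ℕ, n ≤ 8 → z ^ n ≤ 1 + n * ((z ^ 8 - 1) / 8) := by
      intro n hn
      rw [hz]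
      interval_cases n <;> norm_num
    calc ∑ r ∈ Finset.range (2 ^ K), z ^ φ r
        ≤ ∑ r ∈ Finset.range (2 ^ K), (1 + φ r * ((z ^ 8 - 1) / 8)) :=
          Finset.sum_le_sum fun r _ => hconv _ (hφ r)
      _ = 2 ^ K + (∑ r ∈ Finset.range (2 ^ K), (φ r : ℝ)) * ((z ^ 8 - 1) / 8) := by
          rw [Finset.sum_add_distrib, Finset.sum_mul]
          simp
      _ ≤ 2 ^ K + 99 / 32 * 2 ^ K * ((z ^ 8 - 1) / 8) := by
          have : 0 ≤ (z ^ 8 - 1) / 8 := by rw [hz]; norm_num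
          gcongr
      _ = 2 ^ K * (1 + 99 / 32 * ((z ^ 8 - 1) / 8)) := by ring
      _ ≤ 2 ^ K * (1185 / 1000) := by
          gcongr
          rw [hz]
          norm_num
  let B : Set (Fin m → Cube K) := {c | 4 * m ≤ ∑ j, φ (Nat.ofBits (c j))}
  have hevent : {ω : ℕ → Bool | 4 * m ≤ ∑ j ∈ Finset.range m, φ (coinBlock ω K j)} =
      {ω | (fun (j : Fin m) (i : Fin K) => ω (j * K + i)) ∈ B} := by
    ext ω
    simp only [Set.mem_ofPred_eq, B, Finset.sum_range]
    rfl
  have hz0 : 0 < z := by rw [hz]; norm_num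
  have hz1 : 1 ≤ z := by rw [hz]; norm_num
  -- Markov's inequality for the exponential moment, in counting form; independence is the product
  -- formula `Fintype.sum_pow`.
  have hcount : ((Finset.univ.filter (· ∈ B)).card : ℝ) * z ^ (4 * m) ≤
      (2 ^ K * (1185 / 1000)) ^ m := by
    calc ((Finset.univ.filter (· ∈ B)).card : ℝ) * z ^ (4 * m)
        = ∑ _c ∈ Finset.univ.filter (· ∈ B), z ^ (4 * m) := by
          rw [Finset.sum_const, nsmul_eq_mul]
      _ ≤ ∑ c ∈ Finset.univ.filter (· ∈ B), ∏ j, z ^ φ (Nat.ofBits (c j)) := by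
          refine Finset.sum_le_sum fun c hc => ?_
          rw [Finset.prod_pow_eq_pow_sum]
          exact pow_le_pow_right₀ hz1 (Finset.mem_filter.1 hc).2
      _ ≤ ∑ c : Fin m → Cube K, ∏ j, z ^ φ (Nat.ofBits (c j)) :=
          Finset.sum_le_sum_of_subset_of_nonneg (Finset.filter_subset _ _)
            fun c _ _ => Finset.prod_nonneg fun j _ => (pow_pos hz0 _).le
      _ = (∑ r ∈ Finset.range (2 ^ K), z ^ φ r) ^ m := by
          rw [← sum_cube, Fintype.sum_pow]
      _ ≤ _ := by
          refine pow_le_pow_left₀ ?_ hmoment m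
          exact Finset.sum_nonneg fun r _ => (pow_pos hz0 _).le
  rw [hevent]
  refine (coinLaw_blocks_le m K B).trans (ENNReal.ofReal_le_ofReal ?_)
  have hP : (0 : ℝ) < (2 ^ K) ^ m := by positivity
  rw [div_le_iff₀ hP]
  have hzm : (0 : ℝ) < z ^ (4 * m) := by positivity
  refine le_of_mul_le_mul_right (hcount.trans ?_) hzm
  rw [mul_pow, mul_comm ((2 ^ K : ℝ) ^ m), mul_right_comm]
  refine mul_le_mul_of_nonneg_right ?_ hP.le
  -- Per unit of `lb` there are `32` samples, and `1.185 ^ 32 ≤ z ^ 128 / 2` remains.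
  rw [hm, pow_mul, ← mul_assoc, pow_mul z, ← mul_pow]
  refine pow_le_pow_left₀ (by positivity) ?_ lb
  rw [hz]
  norm_num

end RefereedLearning

namespace RefereedLearning

open MeasureTheory

/-! ### The vote of the samples -/

section Vote

variable {Y : Type*} {d lam : ℕ} {ℓ : Y → Y → ℚ} {h : Bool → Cube d → Y} {Q : Cube d → ℚ}
  {f : Cube d → Y}

theorem score_ofBits_point (x : ℕ) :
    score ℓ f h (Nat.ofBits (point d x)) = score ℓ f h x := by
  unfold score
  rw [point_ofBits]

theorem loss_nonneg (hℓ : IsPreciseMetric lam ℓ) (hQ : Q ∈ PreciseDist d lam) (g : Cube d → Y) :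
    0 ≤ loss ℓ Q f g :=
  Finset.sum_nonneg fun x _ => mul_nonneg (hQ.1 x) (hℓ.nonneg _ _)

theorem distance_le_loss_add (hℓ : IsPreciseMetric lam ℓ) (hQ : Q ∈ PreciseDist d lam) :
    ∑ x, Q x * ℓ (h false x) (h true x) ≤ loss ℓ Q f (h false) + loss ℓ Q f (h true) := by
  rw [loss, loss, ← Finset.sum_add_distrib]
  refine Finset.sum_le_sum fun x _ => ?_
  rw [← mul_add]
  refine mul_le_mul_of_nonneg_left ?_ (hQ.1 x)
  rw [hℓ.symm (f x) (h false x)]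
  exact hℓ.triangle _ _ _

theorem loss_le_loss_add (hℓ : IsPreciseMetric lam ℓ) (hQ : Q ∈ PreciseDist d lam) (s : Bool) :
    loss ℓ Q f (h s) ≤ loss ℓ Q f (h !s) + ∑ x, Q x * ℓ (h false x) (h true x) := by
  rw [loss, loss, ← Finset.sum_add_distrib]
  refine Finset.sum_le_sum fun x _ => ?_
  rw [← mul_add]
  refine mul_le_mul_of_nonneg_left ?_ (hQ.1 x)
  cases s
  · rw [hℓ.symm (h false x)]
    exact hℓ.triangle _ _ _
  · exact hℓ.triangle _ _ _

/-- Weighting by `Q * D` cancels the denominator `D` of the score, which makes its mean an affine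
function of the two losses. -/
theorem linear_score :
    ∑ x, Q x * (4 * (ℓ (f x) (h false x) + ℓ (h false x) (h true x) - ℓ (f x) (h true x))) =
      4 * (loss ℓ Q f (h false) + ∑ x, Q x * ℓ (h false x) (h true x) - loss ℓ Q f (h true)) := by
  rw [loss, loss, ← Finset.sum_add_distrib, ← Finset.sum_sub_distrib, Finset.mul_sum]
  exact Finset.sum_congr rfl fun x _ => by ring

/-- Here `Z ≤ L₀ + L₁ < 2 * (L₁ - L₀)`, so the mean score under the exact weights is below `4 * (1 -
1/2) = 2`. The triangle inequality also gives `Z ≥ L₁ - L₀ > 0`, so that there is something to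
sample from. -/
theorem score_le_of_loss_lt (hℓ : IsPreciseMetric lam ℓ) (hQ : Q ∈ PreciseDist d lam)
    (hlt : 3 * loss ℓ Q f (h false) < loss ℓ Q f (h true)) (lb : ℕ) :
    coinLaw {ω | 4 * (32 * lb) ≤ totalScore lam ℓ Q f h ω (32 * lb)} ≤
      ENNReal.ofReal ((1 / 2) ^ lb) := by
  have h0 := loss_nonneg (f := f) hℓ hQ (h false)
  have h₁ := distance_le_loss_add (f := f) (h := h) hℓ hQ
  have h₂ := loss_le_loss_add (f := f) (h := h) hℓ hQ true
  have h₃ := linear_score (ℓ := ℓ) (f := f) (h := h) (Q := Q)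
  simp only [Bool.not_true] at h₂
  have hmean : ∑ x, Q x * ℓ (h false x) (h true x) * (score ℓ f h (Nat.ofBits x) : ℚ) ≤
      3 * ∑ x, Q x * ℓ (h false x) (h true x) := by
    have : ∑ x, Q x * ℓ (h false x) (h true x) * (score ℓ f h (Nat.ofBits x) : ℚ) ≤
        ∑ x, Q x * (4 * (ℓ (f x) (h false x) + ℓ (h false x) (h true x) - ℓ (f x) (h true x))) := by
      refine Finset.sum_le_sum fun x _ => ?_
      have hb := (score_bounds (h := h) hℓ f (Nat.ofBits x)).2.1
      rw [point_ofBits] at hb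
      rw [mul_assoc, mul_comm (ℓ _ _)]
      exact mul_le_mul_of_nonneg_left hb (hQ.1 x)
    linarith
  have hpick := sum_pick_le (g := fun x => (score ℓ f h (Nat.ofBits x) : ℚ)) hℓ hQ
    (fun x => Nat.cast_nonneg _) (by linarith) hmean
  simp only [score_ofBits_point] at hpick
  rw [div_mul_eq_mul_div, le_div_iff₀ (by norm_num), mul_comm] at hpick
  exact chernoff (φ := fun r => score ℓ f h (pick lam ℓ h Q r)) (fun r => (score_bounds hℓ f _).1)
    (by exact_mod_cast hpick)

/-- The mirror image, with the same Chernoff bound applied to `8 - score`. Rounding the score down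
now costs up to `1`, so the mean is at most `9 - 4 * (1 + 1/2) = 3`. This is where the bound `3` in
`sum_pick_le` comes from. -/
theorem score_ge_of_loss_lt (hℓ : IsPreciseMetric lam ℓ) (hQ : Q ∈ PreciseDist d lam)
    (hlt : 3 * loss ℓ Q f (h true) < loss ℓ Q f (h false)) (lb : ℕ) :
    coinLaw {ω | ¬ 4 * (32 * lb) ≤ totalScore lam ℓ Q f h ω (32 * lb)} ≤
      ENNReal.ofReal ((1 / 2) ^ lb) := by
  have h0 := loss_nonneg (f := f) hℓ hQ (h true)
  have h₁ := distance_le_loss_add (f := f) (h := h) hℓ hQ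
  have h₂ := loss_le_loss_add (f := f) (h := h) hℓ hQ false
  have h₃ := linear_score (ℓ := ℓ) (f := f) (h := h) (Q := Q)
  simp only [Bool.not_false] at h₂
  have hle : ∀ x, score ℓ f h x ≤ 8 := fun x => (score_bounds hℓ f x).1
  have hmean : ∑ x, Q x * ℓ (h false x) (h true x) * ((8 - score ℓ f h (Nat.ofBits x) : ℕ) : ℚ) ≤
      3 * ∑ x, Q x * ℓ (h false x) (h true x) := by
    have : ∑ x, Q x * ℓ (h false x) (h true x) * ((8 - score ℓ f h (Nat.ofBits x) : ℕ) : ℚ) ≤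
        9 * (∑ x, Q x * ℓ (h false x) (h true x)) - ∑ x, Q x *
          (4 * (ℓ (f x) (h false x) + ℓ (h false x) (h true x) - ℓ (f x) (h true x))) := by
      rw [Finset.mul_sum, ← Finset.sum_sub_distrib]
      refine Finset.sum_le_sum fun x _ => ?_
      have hb := (score_bounds (h := h) hℓ f (Nat.ofBits x)).2.2
      rw [point_ofBits] at hb
      rw [Nat.cast_sub (hle _)]
      push_cast
      linarith [mul_le_mul_of_nonneg_left hb (hQ.1 x)]
    linarith
  have hpick := sum_pick_le (g := fun x => ((8 - score ℓ f h (Nat.ofBits x) : ℕ) : ℚ)) hℓ hQ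
    (fun x => Nat.cast_nonneg _) (by linarith) hmean
  simp only [score_ofBits_point] at hpick
  rw [div_mul_eq_mul_div, le_div_iff₀ (by norm_num), mul_comm] at hpick
  refine (measure_mono fun ω hω => ?_).trans
    (chernoff (φ := fun r => 8 - score ℓ f h (pick lam ℓ h Q r)) (fun r => Nat.sub_le _ _)
      (by exact_mod_cast hpick))
  simp only [Set.mem_ofPred_eq, totalScore] at hω ⊢
  have hsum : ∑ j ∈ Finset.range (32 * lb), (8 - score ℓ f h (pick lam ℓ h Q
      (coinBlock ω (coinLen lam d) j))) + ∑ j ∈ Finset.range (32 * lb), score ℓ f h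
        (pick lam ℓ h Q (coinBlock ω (coinLen lam d) j)) = 32 * lb * 8 := by
    rw [← Finset.sum_add_distrib, Finset.sum_congr rfl fun j _ => Nat.sub_add_cancel (hle _)]
    simp
  omega

/-- Subadditivity instead of complements avoids proving that the success event is measurable. -/
theorem le_coinLaw_of_union {A B : Set (ℕ → Bool)} {β : ℝ} (hβ : 0 ≤ β)
    (hAB : ∀ ω, ω ∉ B → ω ∈ A) (hB : coinLaw B ≤ ENNReal.ofReal β) :
    ENNReal.ofReal (1 - β) ≤ coinLaw A := by
  rw [ENNReal.ofReal_sub _ hβ, ENNReal.ofReal_one, tsub_le_iff_right, ← measure_univ (μ := coinLaw)]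
  refine (measure_mono fun ω _ => ?_).trans ((measure_union_le A B).trans (by gcongr))
  by_cases hω : ω ∈ B
  · exact .inr hω
  · exact .inl (hAB ω hω)

end Vote

/-! ### The protocol -/

variable {Y : Type*} {lam : ℕ} {ℓ : Y → Y → ℚ}

theorem protocol_run (hℓ : IsPreciseMetric lam ℓ) (I : Input) {Q : Cube I.d → ℚ}
    (hQ : Q ∈ PreciseDist I.d lam) (f : Cube I.d → Y) (h : Bool → Cube I.d → Y) (b : Bool)
    (adv : Strategy) (ω : ℕ → Bool) :
    ∃ s, (protocol lam ℓ).Run (wordSize 9 lam I) ℓ I Q f h b adv ω s ∧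
      s.time ≤ 6400 * (I.logInvBeta + 1) * (I.d + 1) ^ 2 * opTime lam I.d ∧
      s.transcript.bits ≤ 6400 * (I.logInvBeta + 1) * (I.d + 1) ^ 2 * opTime lam I.d ∧
      s.targetQueries = (if I.logInvBeta < 2 then 0 else 32 * I.logInvBeta) ∧
      s.output = if I.logInvBeta < 2 then ω 0 else
        decide (4 * (32 * I.logInvBeta) ≤
          totalScore lam ℓ Q f h ω (32 * I.logInvBeta)) := by
  -- The sum of `32 * lb` scores is at most `256 * lb`, which takes `8` bits more than `lb`; a word
  -- of `9` times the bit length of the parameters holds it.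
  have hw : ∀ v ≤ 256 * I.logInvBeta,
      numCost (wordSize 9 lam I) v ≤ opTime lam I.d := by
    intro v hv
    refine numCost_le_of_word one_le_opTime (Nat.size_le.2 ?_)
    rcases Nat.eq_zero_or_pos I.logInvBeta with h0 | h0
    · rw [h0] at hv
      have : v = 0 := by omega
      rw [this]
      positivity
    · have h₁ := Nat.size_le_size (show I.logInvBeta ≤ I.d + lam + I.invEps + I.logInvBeta by omega)
      have h₂ : 0 < Nat.size I.logInvBeta := Nat.size_pos.2 h0
      have h₃ := Nat.lt_size_self I.logInvBeta
      calc v < 2 ^ (Nat.size I.logInvBeta + 8) := by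
            rw [pow_add]
            omega
        _ ≤ 2 ^ wordSize 9 lam I :=
            Nat.pow_le_pow_right (by norm_num) (by unfold wordSize; omega)
  obtain ⟨t, ht, ht₁, ht₂, ht₃⟩ := runs_verifier (b := b)
    (E :=
      { ℓ := ℓ, Q := Q, f := f, h := h, coins := ω, w := wordSize 9 lam I
        reply := fun p T => if p = b then (protocol lam ℓ).prover b I h Q (T.view b) else adv T })
    ⟨hℓ, hQ, fun T => by simp [protocol]⟩ hw (s := initial Y I) rfl rfl rfl rfl rfl rfl
  -- Every message costs at least its length plus one in time, so the time bound also bounds the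
  -- communication.
  have hbits := ht.bits_le
  simp only [initial, Transcript.bits, List.map_nil, List.sum_nil] at hbits ht₁
  refine ⟨t, ht, by omega, ?_, ht₂, ht₃⟩
  simp only [Transcript.bits]
  omega

theorem one_div_le_two_pow_logInvBeta {β : ℝ} (hβ : 0 < β) :
    1 / β ≤ 2 ^ ⌈Real.logb 2 (1 / β)⌉₊ := by
  have h₁ := Nat.le_ceil (Real.logb 2 (1 / β))
  rw [Real.logb_le_iff_le_rpow (by norm_num) (by positivity), Real.rpow_natCast] at h₁
  exact h₁

theorem protocol_isRefereed (hℓ : IsPreciseMetric lam ℓ) (d : ℕ) {ε β : ℝ} (hε : 0 < ε)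
    (hβ : 0 < β) :
    (protocol lam ℓ).IsRefereed (wordSize 9 lam (Input.of d ε β)) ℓ (Input.of d ε β) (3 + ε) β
      Set.univ (PreciseDist d lam) := by
  intro Q hQ f h _ b adv
  have hrun := protocol_run hℓ (Input.of d ε β) hQ f h b adv
  set lb := (Input.of d ε β).logInvBeta with hlb
  have hpow : 1 / β ≤ 2 ^ lb := one_div_le_two_pow_logInvBeta hβ
  have hpow' : (1 / 2 : ℝ) ^ lb ≤ β := by
    rw [div_pow, one_pow]
    exact (one_div_le (by positivity) hβ).2 hpow
  have n0 : (0 : ℝ) ≤ loss ℓ Q f (h false) := by exact_mod_cast loss_nonneg hℓ hQ _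
  have n1 : (0 : ℝ) ≤ loss ℓ Q f (h true) := by exact_mod_cast loss_nonneg hℓ hQ _
  have hsuccess : ∀ {B : Set (ℕ → Bool)}, coinLaw B ≤ ENNReal.ofReal β →
      (∀ ω, ω ∉ B → (loss ℓ Q f (h (if lb < 2 then ω 0 else
        decide (4 * (32 * lb) ≤ totalScore lam ℓ Q f h ω (32 * lb)))) : ℝ) ≤
          (3 + ε) * min (loss ℓ Q f (h false) : ℝ) (loss ℓ Q f (h true) : ℝ)) →
      ENNReal.ofReal (1 - β) ≤ coinLaw {ω | ∃ s,
        (protocol lam ℓ).Run (wordSize 9 lam (Input.of d ε β)) ℓ (Input.of d ε β) Q f h b adv ω s ∧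
        (loss ℓ Q f (h s.output) : ℝ) ≤
          (3 + ε) * min (loss ℓ Q f (h false) : ℝ) (loss ℓ Q f (h true) : ℝ)} := by
    intro B hB hω
    refine le_coinLaw_of_union hβ.le (fun ω hωB => ?_) hB
    obtain ⟨s, hs, -, -, -, hout⟩ := hrun ω
    refine ⟨s, hs, ?_⟩
    rw [hout]
    exact hω ω hωB
  have hmin : ∀ s : Bool, (loss ℓ Q f (h s) : ℝ) ≤ loss ℓ Q f (h !s) →
      (loss ℓ Q f (h s) : ℝ) ≤
        (3 + ε) * min (loss ℓ Q f (h false) : ℝ) (loss ℓ Q f (h true) : ℝ) := by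
    intro s hs
    cases s
    · rw [Bool.not_false] at hs
      rw [min_eq_left hs]
      nlinarith
    · rw [Bool.not_true] at hs
      rw [min_eq_right hs]
      nlinarith
  -- For `lb < 2` one has `β ≥ 1/2`, and a fair coin hits a hypothesis of least loss with
  -- probability at least `1/2`.
  by_cases hlt : lb < 2
  · obtain ⟨s, hs⟩ : ∃ s : Bool, (loss ℓ Q f (h s) : ℝ) ≤ loss ℓ Q f (h !s) := by
      rcases le_total (loss ℓ Q f (h false) : ℝ) (loss ℓ Q f (h true)) with hle | hle
      · exact ⟨false, hle⟩
      · exact ⟨true, hle⟩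
    have hB : coinLaw {ω | ∀ i < 1, ω i = !s} ≤ ENNReal.ofReal β := by
      rw [coinLaw_prefix 1 fun _ => !s, pow_one]
      have hβ2 : (2⁻¹ : ℝ) ≤ β := by
        refine le_trans ?_ hpow'
        interval_cases lb <;> norm_num
      calc (2⁻¹ : ENNReal) = ENNReal.ofReal 2⁻¹ := by
            rw [ENNReal.ofReal_inv_of_pos (by norm_num)]
            simp
        _ ≤ _ := ENNReal.ofReal_le_ofReal hβ2
    refine hsuccess hB fun ω hω => ?_
    have : ω 0 = s := by simpa using hω
    rw [if_pos hlt, this]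
    exact hmin s hs
  · have hexp : ENNReal.ofReal ((1 / 2) ^ lb) ≤ ENNReal.ofReal β :=
      ENNReal.ofReal_le_ofReal hpow'
    simp only [hlt, if_false] at hsuccess
    by_cases h₁ : 3 * loss ℓ Q f (h false) < loss ℓ Q f (h true)
    · refine hsuccess ((score_le_of_loss_lt hℓ hQ h₁ lb).trans hexp) fun ω hω => ?_
      have hout : decide (4 * (32 * lb) ≤ totalScore lam ℓ Q f h ω (32 * lb)) = false :=
        decide_eq_false hω
      rw [hout]
      refine hmin false ?_
      have h₂ : (3 * loss ℓ Q f (h false) : ℝ) < loss ℓ Q f (h true) := by exact_mod_cast h₁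
      simp only [Bool.not_false]
      linarith
    by_cases h₂ : 3 * loss ℓ Q f (h true) < loss ℓ Q f (h false)
    · refine hsuccess ((score_ge_of_loss_lt hℓ hQ h₂ lb).trans hexp) fun ω hω => ?_
      have hout : decide (4 * (32 * lb) ≤ totalScore lam ℓ Q f h ω (32 * lb)) = true :=
        decide_eq_true (not_not.1 hω)
      rw [hout]
      refine hmin true ?_
      have h₂ : (3 * loss ℓ Q f (h true) : ℝ) < loss ℓ Q f (h false) := by exact_mod_cast h₂
      simp only [Bool.not_true]
      linarith
    -- Neither loss exceeds three times the other, so both outputs are acceptable.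
    · refine hsuccess (B := ∅) (by simp) fun ω _ => ?_
      have h₁' : (loss ℓ Q f (h true) : ℝ) ≤ 3 * loss ℓ Q f (h false) := by
        exact_mod_cast not_lt.1 h₁
      have h₂' : (loss ℓ Q f (h false) : ℝ) ≤ 3 * loss ℓ Q f (h true) := by
        exact_mod_cast not_lt.1 h₂
      have key : ∀ s : Bool, (loss ℓ Q f (h s) : ℝ) ≤
          3 * min (loss ℓ Q f (h false) : ℝ) (loss ℓ Q f (h true) : ℝ) := by
        intro s
        rw [mul_min_of_nonneg _ _ (by norm_num)]
        cases s
        · exact le_min (by linarith) h₂'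
        · exact le_min h₁' (by linarith)
      refine (key _).trans ?_
      have := le_min n0 n1
      nlinarith

theorem protocol_hasComplexity (hℓ : IsPreciseMetric lam ℓ) (d : ℕ) {ε β : ℝ} (hε : 0 < ε) :
    (protocol lam ℓ).HasComplexity (wordSize 9 lam (Input.of d ε β)) ℓ (Input.of d ε β)
      Set.univ (PreciseDist d lam)
      ((1024000 : ℕ) * costFactor lam ε β * ((d : ℝ) + 1) ^ 3)
      ((1024000 : ℕ) * costFactor lam ε β * ((d : ℝ) + 1) ^ 3)
      ((1024000 : ℕ) * (1 + 1 / ε ^ 2) * max 0 (Real.log (1 / β))) := by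
  intro Q hQ f h _ b adv ω
  obtain ⟨s, hs, htime, hbits, hqueries, -⟩ := protocol_run hℓ (Input.of d ε β) hQ f h b adv ω
  set lb := (Input.of d ε β).logInvBeta with hlb
  have hlb' : lb = ⌈Real.logb 2 (1 / β)⌉₊ := rfl
  have hlog2 : (0.69 : ℝ) < Real.log 2 := by linarith [Real.log_two_gt_d9]
  have hlogb : Real.log (1 / β) = Real.logb 2 (1 / β) * Real.log 2 := by
    rw [Real.logb, div_mul_cancel₀ _ (by linarith)]
  -- `lb + 1` is less than `log (1 / β) / log 2 + 2` if the logarithm is positive, and `1 / log 2 <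
  -- 2`.
  have hlb1 : ((lb : ℝ) + 1) ≤ 4 * max 1 (Real.log (1 / β)) := by
    rcases le_or_gt (Real.logb 2 (1 / β)) 0 with h0 | h0
    · have : lb = 0 := by rw [hlb', Nat.ceil_eq_zero.2 h0]
      rw [this]
      have := le_max_left 1 (Real.log (1 / β))
      push_cast
      linarith
    · have h₁ : (lb : ℝ) < Real.logb 2 (1 / β) + 1 := Nat.ceil_lt_add_one h0.le
      have h₂ := le_max_left 1 (Real.log (1 / β))
      have h₃ := le_max_right 1 (Real.log (1 / β))
      nlinarith
  have hε2 : 0 < 1 / ε ^ 2 := by positivity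
  have htotal : ((6400 * (lb + 1) * (d + 1) ^ 2 * opTime lam d : ℕ) : ℝ) ≤
      (1024000 : ℕ) * costFactor lam ε β * ((d : ℝ) + 1) ^ 3 := by
    have hop : (opTime lam d : ℝ) ≤ 40 * (max 1 (lam : ℝ) * ((d : ℝ) + 1)) := by
      have h₁ := le_max_left 1 (lam : ℝ)
      have h₂ := le_max_right 1 (lam : ℝ)
      have h₃ : (0 : ℝ) ≤ d := Nat.cast_nonneg d
      unfold opTime
      push_cast
      nlinarith [mul_nonneg (sub_nonneg.2 h₁) h₃]
    have hcost : max 1 (lam : ℝ) * max 1 (Real.log (1 / β)) ≤ costFactor lam ε β := by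
      unfold costFactor
      have h₁ : (1 : ℝ) ≤ (1 + 1 / ε ^ 2) * max 1 (Real.log (1 + 1 / ε)) :=
        one_le_mul_of_one_le_of_one_le (by linarith) (le_max_left _ _)
      have h₂ : (0 : ℝ) ≤ max 1 (lam : ℝ) * max 1 (Real.log (1 / β)) := by positivity
      calc _ ≤ max 1 (lam : ℝ) * max 1 (Real.log (1 / β)) *
            ((1 + 1 / ε ^ 2) * max 1 (Real.log (1 + 1 / ε))) := le_mul_of_one_le_right h₂ h₁
        _ = _ := by ring
    calc ((6400 * (lb + 1) * (d + 1) ^ 2 * opTime lam d : ℕ) : ℝ)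
        = 6400 * ((lb : ℝ) + 1) * ((d : ℝ) + 1) ^ 2 * opTime lam d := by push_cast; ring
      _ ≤ 6400 * (4 * max 1 (Real.log (1 / β))) * ((d : ℝ) + 1) ^ 2 *
          (40 * (max 1 (lam : ℝ) * ((d : ℝ) + 1))) := by gcongr
      _ = 1024000 * (max 1 (lam : ℝ) * max 1 (Real.log (1 / β))) * ((d : ℝ) + 1) ^ 3 := by ring
      _ ≤ 1024000 * costFactor lam ε β * ((d : ℝ) + 1) ^ 3 := by gcongr
      _ = _ := by norm_num
  refine ⟨s, hs, le_trans (by exact_mod_cast htime) htotal,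
    le_trans (by exact_mod_cast hbits) htotal, ?_⟩
  have hmax := le_max_left 0 (Real.log (1 / β))
  rw [hqueries]
  split_ifs with hlt
  · push_cast
    positivity
  · have h0 : 1 < Real.logb 2 (1 / β) := by
      by_contra hle
      have : lb ≤ 1 := by
        rw [hlb']
        exact Nat.ceil_le.2 (by simpa using not_lt.1 hle)
      omega
    -- The case `lb < 2` being excluded, the binary logarithm exceeds `1` and absorbs the rounding:
    -- `lb` is less than twice the logarithm.
    have h₁ : (lb : ℝ) < Real.logb 2 (1 / β) + 1 := Nat.ceil_lt_add_one (by linarith)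
    have h₂ := le_max_right 0 (Real.log (1 / β))
    have h₃ : (32 * lb : ℝ) ≤ 1024000 * max 0 (Real.log (1 / β)) := by nlinarith
    calc ((32 * lb : ℕ) : ℝ) = 32 * (lb : ℝ) := by push_cast; ring
      _ ≤ 1024000 * max 0 (Real.log (1 / β)) := h₃
      _ ≤ 1024000 * (1 + 1 / ε ^ 2) * max 0 (Real.log (1 / β)) := by
          refine mul_le_mul_of_nonneg_right ?_ hmax
          linarith
      _ = _ := by norm_num

end RefereedLearning

theorem theorem4p4 :
    ∃ C c k : ℕ, ∀ (Y : Type*) (lam : ℕ) (ℓ : Y → Y → ℚ),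
      RefereedLearning.IsPreciseMetric lam ℓ →
      ∃ P : RefereedLearning.Protocol Y, ∀ (d : ℕ) (ε β : ℝ), 0 < ε → 0 < β →
        P.IsRefereed (RefereedLearning.wordSize c lam (RefereedLearning.Input.of d ε β)) ℓ
          (RefereedLearning.Input.of d ε β) (3 + ε) β
          Set.univ (RefereedLearning.PreciseDist d lam) ∧
        P.HasComplexity (RefereedLearning.wordSize c lam (RefereedLearning.Input.of d ε β)) ℓ
          (RefereedLearning.Input.of d ε β)
          Set.univ (RefereedLearning.PreciseDist d lam)
          (C * RefereedLearning.costFactor lam ε β * ((d : ℝ) + 1) ^ k)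
          (C * RefereedLearning.costFactor lam ε β * ((d : ℝ) + 1) ^ k)
          (C * (1 + 1 / ε ^ 2) * max 0 (Real.log (1 / β))) := by
  -- The constant is `6400 * 4 * 40`, with `4` from `lb + 1` and `40` from `opTime`. The degree `3`
  -- combines `(d + 1) ^ 2` with the factor `d + 1` in the bound for `opTime`.
  refine ⟨1024000, 9, 3, fun Y lam ℓ hℓ => ⟨RefereedLearning.protocol lam ℓ, fun d ε β hε hβ => ?_⟩⟩
  exact ⟨RefereedLearning.protocol_isRefereed hℓ d hε hβ,
    RefereedLearning.protocol_hasComplexity hℓ d hε⟩
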